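/- Let $m\in\mathbb N$, and let $\mathcal G$ be a finite collection of colored chain posets $(i_1\prec\cdots\prec i_\ell)$, each of order $\ell\ge 2$, with colors $i_j\in\{1,\dots,m\}$; assume that $\mathcal G$ is sparse, i.e. for every color $c$ it contains a monochromatic chain $(c\prec\cdots\prec c)$ of some order. Let $\overline\beta=(\beta_1,\dots,\beta_m)\in(\mathbb R_{>0})^m$. A colored subset of $\mathcal P([n])$ is a subset $S\subset\mathcal P([n])$ with a coloring $c:S\to\{1,\dots,m\}$; it is valid if there are no $(i_1\prec\cdots\prec i_\ell)\in\mathcal G$ and $x_1\subsetneq\cdots\subsetneq x_\ell$ in $S$ with $c(x_j)=i_j$ for all $j$. A template is a function $T:\mathcal P([n])\to\mathcal P(\{1,\dots,m\})$; its support is $\{x: T(x)\ne\emptyset\}$, its size is $|T|=\sum_x|T(x)|$, and its weight is $\omega(\overline\beta,T)=\sum_{x\in\mathcal P([n])}\log\bigl(1+\sum_{i\in T(x)}\beta_i\bigr)$. It is valid if every coloring of its support that assigns to each $x$ an element of $T(x)$ is valid. A colored subset is contained in $T$ if the color of each of its elements $x$ lies in $T(x)$, and $T'$ is a sub-template of $T$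 if $T'(x)\subseteq T(x)$ for all $x$. Let $\omega_{crit}(\overline\beta)$ be the maximum of $\omega(\overline\beta,T)$ over all valid templates $T$ (on $\mathcal P([n])$, for any $n$) whose support is a chain. Then there is a constant $K>0$, depending only on $m$, $\mathcal G$ and $\overline\beta$, such that for every $\alpha\in(0,1)$ there exists $\epsilon>0$ such that the following holds. Let $n\in\mathbb N$, and let $T$ be a template on $\mathcal P([n])$ supported on sets of size between $\frac n3$ and $\frac{2n}3$ (inclusive) such that $\omega(\overline\beta,T)\ge(\omega_{crit}(\overline\beta)+\alpha)\binom{n}{\lfloor n/2\rfloor}$. Then there exists a family $\mathcal C$ of sub-templates of $T$ such that 1. for every validly colored subset $I$ contained in $T$ there is $T'\in\mathcal C$ such that $I$ is contained in $T'$; 2. $|\mathcal C|\le e^{K\frac{\log n}{n}|T|}$; 3. $|T'|\le(1-\epsilon)|T|$ for every $T'\in\mathcal C$. -/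

import Mathlib

namespace ColoredChains

/-- A colored subset of `𝒫([n])` with colors `Fin m`: a partial coloring, where `none` means that
the point is not in the subset and `some c` that it is in the subset with color `c`. -/
abbrev ColoredSubset (n m : ℕ) : Type := Finset (Fin n) → Option (Fin m)

/-- The colored chain poset `i₁ ≺ ⋯ ≺ i_ℓ`, written as the list `[i₁, …, i_ℓ]` of its colors from
bottom to top, appears as a colored subchain of `S`. -/
def ColoredSubset.HasSubchain {n m : ℕ} (S : ColoredSubset n m) (g : List (Fin m)) : Prop :=
  ∃ x : Fin g.length → Finset (Fin n), StrictMono x ∧ ∀ i, S (x i) = some (g.get i)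

/-- `S` is valid with respect to `𝒢`: no element of `𝒢` appears as a colored subchain of `S`. -/
def ColoredSubset.Valid {n m : ℕ} (𝒢 : Finset (List (Fin m))) (S : ColoredSubset n m) : Prop :=
  ∀ g ∈ 𝒢, ¬ S.HasSubchain g

/-- A template: a function `𝒫([n]) → 𝒫({1, …, m})`. Sub-templates are given by the pointwise
order `T' ≤ T`, that is `T' x ⊆ T x` for all `x`. -/
abbrev Template (n m : ℕ) : Type := Finset (Fin n) → Finset (Fin m)

/-- The support of a template. -/
def Template.supp {n m : ℕ} (T : Template n m) : Finset (Finset (Fin n)) :=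
  Finset.univ.filter fun x => (T x).Nonempty

/-- `S` is a coloring of (exactly) `Supp(T)` that gives each `x ∈ Supp(T)` an element of `T x`. -/
def Template.IsFullColoring {n m : ℕ} (T : Template n m) (S : ColoredSubset n m) : Prop :=
  (∀ x ∈ T.supp, ∃ c ∈ T x, S x = some c) ∧ ∀ x ∉ T.supp, S x = none

/-- A template is valid if each coloring of its support by allowed colors is valid. -/
def Template.Valid {n m : ℕ} (𝒢 : Finset (List (Fin m))) (T : Template n m) : Prop :=
  ∀ S : ColoredSubset n m, T.IsFullColoring S → S.Valid 𝒢

/-- The colored subset `S` is contained in the template `T`. -/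
def ColoredSubset.ContainedIn {n m : ℕ} (S : ColoredSubset n m) (T : Template n m) : Prop :=
  ∀ x c, S x = some c → c ∈ T x

/-- The size `|T|`: the number of pairs `(x, c)` with `c ∈ T x`. -/
def Template.size {n m : ℕ} (T : Template n m) : ℕ := ∑ x, (T x).card

/-- The weight `ω(β, T) = ∑ₓ log (1 + ∑_{i ∈ T x} βᵢ)`. -/
noncomputable def Template.weight {n m : ℕ} (β : Fin m → ℝ) (T : Template n m) : ℝ :=
  ∑ x, Real.log (1 + ∑ i ∈ T x, β i)

/-- `𝒢` is sparse: it forbids a monochromatic chain of every color. -/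
def Sparse {m : ℕ} (𝒢 : Finset (List (Fin m))) : Prop :=
  ∀ c : Fin m, ∃ ℓ : ℕ, List.replicate ℓ c ∈ 𝒢

/-- The weights of valid templates (on any `𝒫([n])`) whose support is a chain. -/
def chainWeights {m : ℕ} (𝒢 : Finset (List (Fin m))) (β : Fin m → ℝ) : Set ℝ :=
  {w | ∃ (n : ℕ) (T : Template n m), T.Valid 𝒢 ∧
    IsChain (· ⊆ ·) (T.supp : Set (Finset (Fin n))) ∧ w = T.weight β}

/-- The critical weight `ω_crit(β)`, the largest weight of a valid template supported on a chain.
For sparse `𝒢` the maximum exists, see `isGreatest_omegaCrit`. -/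
noncomputable def omegaCrit {m : ℕ} (𝒢 : Finset (List (Fin m))) (β : Fin m → ℝ) : ℝ :=
  sSup (chainWeights 𝒢 β)

theorem card_supp_le {m : ℕ} {𝒢 : Finset (List (Fin m))} (h𝒢 : Sparse 𝒢) {n : ℕ}
    {T : Template n m} (hT : T.Valid 𝒢)
    (hc : IsChain (· ⊆ ·) (T.supp : Set (Finset (Fin n)))) :
    T.supp.card ≤ m * 𝒢.sup List.length := by
  classical
  by_contra! hlt
  have hex : ∀ x ∈ T.supp, ∃ c, c ∈ T x := fun x hx => (Finset.mem_filter.1 hx).2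
  let S : ColoredSubset n m := fun x => if h : x ∈ T.supp then some (hex x h).choose else none
  have hS : T.IsFullColoring S :=
    ⟨fun x hx => ⟨_, (hex x hx).choose_spec, by simp [S, hx]⟩, fun x hx => by simp [S, hx]⟩
  obtain ⟨y, -, hy⟩ := Finset.exists_lt_card_fiber_of_mul_lt_card_of_maps_to
    (s := T.supp) (t := (Finset.univ : Finset (Fin m)).image some) (f := S)
    (n := 𝒢.sup List.length)
    (fun x hx => by simp [S, hx])
    (by rwa [Finset.card_image_of_injective _ (Option.some_injective _), Finset.card_univ,
      Fintype.card_fin])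
  obtain ⟨x₀, hx₀⟩ := Finset.card_pos.1 (lt_of_le_of_lt (Nat.zero_le _) hy)
  rw [Finset.mem_filter] at hx₀
  obtain ⟨c, -, hcx⟩ := hS.1 x₀ hx₀.1
  obtain ⟨ℓ, hℓ⟩ := h𝒢 c
  have hle : ℓ ≤ 𝒢.sup List.length := by
    simpa using Finset.le_sup (f := List.length) hℓ
  set A := T.supp.filter fun x => S x = y with hA
  have hinj : Set.InjOn Finset.card (A : Set (Finset (Fin n))) := by
    intro a ha b hb hab
    have ha' : a ∈ T.supp := (Finset.mem_filter.1 ha).1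
    have hb' : b ∈ T.supp := (Finset.mem_filter.1 hb).1
    rcases hc.total ha' hb' with h | h
    · exact Finset.eq_of_subset_of_card_le h hab.ge
    · exact (Finset.eq_of_subset_of_card_le h hab.le).symm
  have hcard : ℓ ≤ (A.image Finset.card).card := by
    rw [Finset.card_image_of_injOn hinj]; omega
  let e := Finset.orderEmbOfCardLe (A.image Finset.card) hcard
  have he : ∀ i, ∃ a ∈ A, a.card = e i := fun i =>
    Finset.mem_image.1 (Finset.orderEmbOfCardLe_mem _ hcard i)
  choose a haA hae using he
  refine hT S hS _ hℓ ⟨fun i => a (Fin.cast (by simp) i), ?_, ?_⟩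
  · intro i j hij
    have hlt' : (a (Fin.cast (by simp) i)).card < (a (Fin.cast (by simp) j)).card := by
      rw [hae, hae]; exact e.strictMono (by simpa using hij)
    rcases hc.total (Finset.mem_filter.1 (haA (Fin.cast (by simp) i))).1
      (Finset.mem_filter.1 (haA (Fin.cast (by simp) j))).1 with h | h
    · exact Finset.ssubset_iff_subset_ne.2 ⟨h, fun h' => hlt'.ne (congrArg Finset.card h')⟩
    · exact absurd (Finset.card_le_card h) (by omega)
  · intro i
    rw [(Finset.mem_filter.1 (haA _)).2, ← hx₀.2, hcx]
    simp

/-- For sparse `𝒢` the maximum in the definition of `ω_crit(β)` is attained. -/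
theorem isGreatest_omegaCrit {m : ℕ} {𝒢 : Finset (List (Fin m))} (h𝒢 : Sparse 𝒢)
    (h2 : ∀ g ∈ 𝒢, 2 ≤ g.length) (β : Fin m → ℝ) :
    IsGreatest (chainWeights 𝒢 β) (omegaCrit 𝒢 β) := by
  classical
  have hne : (chainWeights 𝒢 β).Nonempty := by
    refine ⟨_, 0, fun _ => ∅, ?_, ?_, rfl⟩
    · intro S hS g hg ⟨x, _, hx⟩
      have h0 := hS.2 (x ⟨0, by have := h2 g hg; omega⟩) (by simp [Template.supp])
      rw [hx] at h0
      simp at h0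
    · simp [Template.supp]
  have hfin : (chainWeights 𝒢 β).Finite := by
    let F : Multiset (Finset (Fin m)) → ℝ :=
      fun M => (M.map fun s => Real.log (1 + ∑ i ∈ s, β i)).sum
    refine Set.Finite.subset (Set.finite_iUnion (ι := Fin (m * 𝒢.sup List.length + 1))
      fun k => Set.finite_range fun M : Sym (Finset (Fin m)) k => F M.1) ?_
    rintro w ⟨n, T, hT, hc, rfl⟩
    refine Set.mem_iUnion.2 ⟨⟨_, Nat.lt_succ_of_le (card_supp_le h𝒢 hT hc)⟩,
      ⟨T.supp.val.map T, by simp⟩, ?_⟩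
    simp only [F, Multiset.map_map, Template.weight]
    refine Finset.sum_subset (Finset.subset_univ T.supp) fun x _ hx => ?_
    have : T x = ∅ := by simpa [Template.supp, Finset.not_nonempty_iff_eq_empty] using hx
    simp [this]
  exact ⟨hne.csSup_mem hfin, fun w hw => le_csSup hfin.bddAbove hw⟩

end ColoredChains

/-!
*Supersaturation.* Along a maximal chain, pack forbidden colored chains fractionally and greedily.
The pairs (vertex, color) that are left unsaturated form a valid template supported on a chain, so
their weight is at most `ω_crit`, and every excess of the weight of `T` over the critical one is
paid for by the packing. Averaging over all maximal chains, with a set `x` counted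
`(n choose |x|) / (n choose n/2)` times, gives a weighted hypergraph of forbidden colored chains on
the pairs `(x, c)` with `c ∈ T x`, of total weight of order `|T|`. Among the maximal chains through
given sets, a proportion of at most `1 / ((1 - θ) n)` passes through one more given set that
contains them and has size at most `θ n`, so the degree of a set of `j` pairs is at most about
`n ^ (1 - j)`.

*Containers.* In a hypergraph with such degrees, an independent set `I` gets a fingerprint `S ⊆ I`
that maximizes the value of the link of `S` minus a linear cost. Either the vertices that `S` does
not exclude are a definite proportion fewer, or the link of `S` is again a hypergraph with small
degrees, of smaller rank, in which `I` is independent, and one inducts on the rank. Fingerprints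
have `O(|T| / n)` elements, so there are `exp (O(log n / n) |T|)` of them.
-/

namespace ColoredChains

open Finset

section Link

variable {α : Type*} [DecidableEq α] {w w' : Finset α → ℝ} {v : α}

/-- The link of the vertex set `S` in the weighted hypergraph `w`: the weight of `B` is the total
weight of the edges that consist of `B` and one more vertex, taken from `S`. -/
def link (S : Finset α) (w : Finset α → ℝ) (B : Finset α) : ℝ :=
  ∑ v ∈ S \ B, w (insert v B)

theorem link_nonneg (S : Finset α) (hw : 0 ≤ w) : 0 ≤ link S w :=
  fun _ => sum_nonneg fun _ _ => hw _

theorem link_mono (S : Finset α) (h : w ≤ w') : link S w ≤ link S w' :=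
  fun _ => sum_le_sum fun _ _ => h _

theorem exists_insert_ne_zero_of_le_link {S B : Finset α} (hw' : 0 ≤ w')
    (h : w' ≤ link S w) (hB : w' B ≠ 0) : ∃ v ∈ S \ B, w (insert v B) ≠ 0 := by
  by_contra! hzero
  exact hB (((h B).trans_eq (sum_eq_zero hzero)).antisymm (hw' B))

theorem card_le_of_le_link {S : Finset α} {k : ℕ} (hw' : 0 ≤ w') (h : w' ≤ link S w)
    (hrank : ∀ A, w A ≠ 0 → #A ≤ k + 1) {B : Finset α} (hB : w' B ≠ 0) : #B ≤ k := by
  obtain ⟨v, hv, hvB⟩ := exists_insert_ne_zero_of_le_link hw' h hB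
  have hcard := hrank _ hvB
  rw [card_insert_of_notMem (mem_sdiff.1 hv).2] at hcard
  exact Nat.le_of_succ_le_succ hcard

theorem link_singleton_apply (v : α) (w : Finset α → ℝ) (B : Finset α) :
    link {v} w B = if v ∈ B then 0 else w (insert v B) := by
  split_ifs with hv
  · rw [link, sdiff_eq_empty_iff_subset.2 (singleton_subset_iff.2 hv), sum_empty]
  · rw [link, sdiff_eq_self_of_disjoint (disjoint_singleton_left.2 hv), sum_singleton]

theorem link_insert {S : Finset α} (hv : v ∉ S) (w : Finset α → ℝ) :
    link (insert v S) w = link S w + link {v} w := by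
  ext B
  rw [Pi.add_apply, link, link, link, insert_eq, union_sdiff_distrib, sum_union, add_comm]
  exact disjoint_of_subset_left sdiff_subset
    (disjoint_of_subset_right sdiff_subset (disjoint_singleton_left.2 hv))

end Link

section Degree

variable {α : Type*} [Fintype α] [DecidableEq α] {w w' : Finset α → ℝ} {X A : Finset α} {v : α}

/-- The degree of `X` in the weighted hypergraph on `α` with edge weights `w`, that is the total
weight of the edges that contain `X`. It is linear in `w`, and `degree ∅ w` is the total weight. -/
noncomputable def degree (X : Finset α) : (Finset α → ℝ) →ₗ[ℝ] ℝ :=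
  ∑ A with X ⊆ A, LinearMap.proj A

theorem degree_apply (X : Finset α) (w : Finset α → ℝ) : degree X w = ∑ A with X ⊆ A, w A := by
  simp [degree]

theorem degree_empty (w : Finset α → ℝ) : degree ∅ w = ∑ A, w A := by
  simp [degree_apply]

theorem degree_mono (X : Finset α) (h : w ≤ w') : degree X w ≤ degree X w' := by
  simpa only [degree_apply] using sum_le_sum fun A _ => h A

theorem degree_nonneg (X : Finset α) (hw : 0 ≤ w) : 0 ≤ degree X w := by
  simpa using degree_mono X hw

theorem degree_antitone (hw : 0 ≤ w) {Y : Finset α} (hXY : X ⊆ Y) : degree Y w ≤ degree X w := by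
  simp only [degree_apply]
  exact sum_le_sum_of_subset_of_nonneg (monotone_filter_right _ fun A _ => hXY.trans)
    fun A _ _ => hw A

theorem degree_eq_zero (h : ∀ A, X ⊆ A → w A = 0) : degree X w = 0 := by
  rw [degree_apply]
  exact sum_eq_zero fun A hA => h A (mem_filter.1 hA).2

theorem degree_single (X A : Finset α) (r : ℝ) :
    degree X (Pi.single A r) = if X ⊆ A then r else 0 := by
  simp [degree_apply, Pi.single_apply]

theorem sum_degree_singleton (w : Finset α → ℝ) : ∑ v, degree {v} w = ∑ A, #A * w A := by
  simp only [degree_apply, sum_filter, singleton_subset_iff]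
  rw [sum_comm]
  exact sum_congr rfl fun A _ => by simp [sum_ite_mem]

theorem sum_degree_singleton_le {k : ℕ} (hw : 0 ≤ w) (hrank : ∀ A, w A ≠ 0 → #A ≤ k) :
    ∑ v, degree {v} w ≤ k * degree ∅ w := by
  rw [sum_degree_singleton, degree_empty, mul_sum]
  refine sum_le_sum fun A _ => ?_
  rcases eq_or_ne (w A) 0 with h | h
  · simp [h]
  · exact mul_le_mul_of_nonneg_right (mod_cast hrank A h) (hw A)

theorem sum_degree (w : Finset α → ℝ) : ∑ X, degree X w = ∑ A, 2 ^ #A * w A := by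
  simp only [degree_apply, sum_filter]
  rw [sum_comm]
  refine sum_congr rfl fun A _ => ?_
  rw [← sum_filter, filter_subset_univ, sum_const, card_powerset, nsmul_eq_mul, Nat.cast_pow,
    Nat.cast_ofNat]

theorem degree_link_of_mem (hv : v ∈ X) (w : Finset α → ℝ) : degree X (link {v} w) = 0 :=
  degree_eq_zero fun B hB => by rw [link_singleton_apply, if_pos (hB hv)]

theorem degree_link_of_notMem (hv : v ∉ X) (w : Finset α → ℝ) :
    degree X (link {v} w) = degree (insert v X) w := by
  simp only [degree_apply, link_singleton_apply]
  rw [← sum_filter_of_ne (p := (v ∉ ·)) (fun B _ h hB => h (if_pos hB))]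
  refine sum_bij' (fun B _ => insert v B) (fun A _ => A.erase v) ?_ ?_ ?_ ?_ ?_ <;>
    simp only [mem_filter, mem_univ, true_and, insert_subset_iff]
  · exact fun B hB => ⟨mem_insert_self v B, hB.1.trans (subset_insert v B)⟩
  · exact fun A hA => ⟨subset_erase.2 ⟨hA.2, hv⟩, notMem_erase v A⟩
  · exact fun B hB => erase_insert hB.2
  · exact fun A hA => insert_erase hA.1
  · exact fun B hB => if_neg hB.2

end Degree

section LinkWeights

variable {α : Type*} [Fintype α] [DecidableEq α] {w g : Finset α → ℝ} {cap : ℕ → ℝ}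
  {S : Finset α} {v : α}

/-- The weighted hypergraphs below the link of `S` in which sets of `j` vertices have degree at
most `cap j`. -/
def linkWeights (w : Finset α → ℝ) (cap : ℕ → ℝ) (S : Finset α) : Set (Finset α → ℝ) :=
  {g | g ∈ Set.Icc 0 (link S w) ∧ ∀ X, degree X g ≤ cap #X}

/-- The largest total weight of an element of `linkWeights w cap S`. It measures the progress of
the fingerprint `S` in the container algorithm. -/
noncomputable def linkValue (w : Finset α → ℝ) (cap : ℕ → ℝ) (S : Finset α) : ℝ :=
  sSup (degree ∅ '' linkWeights w cap S)

theorem zero_mem_linkWeights (hw : 0 ≤ w) (hcap : ∀ j, 0 ≤ cap j) (S : Finset α) :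
    0 ∈ linkWeights w cap S :=
  ⟨⟨le_rfl, link_nonneg S hw⟩, fun X => by simpa using hcap #X⟩

theorem isCompact_linkWeights (w : Finset α → ℝ) (cap : ℕ → ℝ) (S : Finset α) :
    IsCompact (linkWeights w cap S) := by
  rw [linkWeights, Set.ofPred_and, Set.ofPred_forall]
  exact isCompact_Icc.inter_right (isClosed_iInter fun X =>
    isClosed_le (degree X).continuous_of_finiteDimensional continuous_const)

theorem isGreatest_linkValue (hw : 0 ≤ w) (hcap : ∀ j, 0 ≤ cap j) (S : Finset α) :
    IsGreatest (degree ∅ '' linkWeights w cap S) (linkValue w cap S) :=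
  ((isCompact_linkWeights w cap S).image (degree ∅).continuous_of_finiteDimensional).isGreatest_sSup
    (Set.Nonempty.image _ ⟨0, zero_mem_linkWeights hw hcap S⟩)

theorem degree_empty_le_linkValue (hw : 0 ≤ w) (hcap : ∀ j, 0 ≤ cap j)
    (hg : g ∈ linkWeights w cap S) : degree ∅ g ≤ linkValue w cap S :=
  (isGreatest_linkValue hw hcap S).2 (Set.mem_image_of_mem _ hg)

theorem exists_degree_empty_eq_linkValue (hw : 0 ≤ w) (hcap : ∀ j, 0 ≤ cap j) (S : Finset α) :
    ∃ g ∈ linkWeights w cap S, degree ∅ g = linkValue w cap S :=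
  (isGreatest_linkValue hw hcap S).1

theorem linkValue_nonneg (hw : 0 ≤ w) (hcap : ∀ j, 0 ≤ cap j) (S : Finset α) :
    0 ≤ linkValue w cap S := by
  simpa using degree_empty_le_linkValue hw hcap (zero_mem_linkWeights hw hcap S)

theorem linkValue_le (hw : 0 ≤ w) (hcap : ∀ j, 0 ≤ cap j) (S : Finset α) :
    linkValue w cap S ≤ cap 0 := by
  obtain ⟨g, hg, hgS⟩ := exists_degree_empty_eq_linkValue hw hcap S
  exact hgS ▸ hg.2 ∅

/-- The edges of `w` without a nonempty subset whose degree in `g` is more than half of the bound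
`cap`. The others are in danger of violating that bound when their links are added to `g`. -/
noncomputable def lightPart (w : Finset α → ℝ) (cap : ℕ → ℝ) (g : Finset α → ℝ) :
    Finset α → ℝ :=
  Set.indicator {A | ∀ X ⊆ A, X.Nonempty → degree X g ≤ cap #X / 2} w

theorem lightPart_nonneg (hw : 0 ≤ w) (cap : ℕ → ℝ) (g : Finset α → ℝ) :
    0 ≤ lightPart w cap g :=
  Set.indicator_nonneg fun A _ => hw A

theorem lightPart_le (hw : 0 ≤ w) (cap : ℕ → ℝ) (g : Finset α → ℝ) : lightPart w cap g ≤ w :=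
  Set.indicator_le_self' fun A _ => hw A

theorem add_link_lightPart_mem_linkWeights (hw : 0 ≤ w)
    (hdeg : ∀ X : Finset α, X.Nonempty → degree X w ≤ cap (#X - 1) / 2)
    (hg : g ∈ linkWeights w cap S) (hg0 : degree ∅ g ≤ cap 0 / 2) (hv : v ∉ S) :
    g + link {v} (lightPart w cap g) ∈ linkWeights w cap (insert v S) := by
  refine ⟨⟨add_nonneg hg.1.1 (link_nonneg _ (lightPart_nonneg hw cap g)), ?_⟩, fun X => ?_⟩
  · rw [link_insert hv]
    exact add_le_add hg.1.2 (link_mono _ (lightPart_le hw cap g))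
  rw [map_add]
  by_cases hvX : v ∈ X
  · rw [degree_link_of_mem hvX, add_zero]
    exact hg.2 X
  rw [degree_link_of_notMem hvX]
  by_cases hX : X.Nonempty ∧ cap #X / 2 < degree X g
  · have hlight : degree (insert v X) (lightPart w cap g) = 0 :=
      degree_eq_zero fun A hA => Set.indicator_of_notMem (mt Set.mem_ofPred.1 fun hA' =>
        hX.2.not_ge (hA' X ((subset_insert v X).trans hA) hX.1)) w
    rw [hlight, add_zero]
    exact hg.2 X
  · have hgX : degree X g ≤ cap #X / 2 := by
      rcases X.eq_empty_or_nonempty with rfl | hne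
      · exact hg0
      · exact not_lt.1 fun h => hX ⟨hne, h⟩
    have hwX := hdeg (insert v X) (insert_nonempty v X)
    rw [card_insert_of_notMem hvX, Nat.add_sub_cancel] at hwX
    linarith [degree_mono (insert v X) (lightPart_le hw cap g)]

theorem degree_lightPart_le_linkValue_sub (hw : 0 ≤ w) (hcap : ∀ j, 0 ≤ cap j)
    (hdeg : ∀ X : Finset α, X.Nonempty → degree X w ≤ cap (#X - 1) / 2)
    (hg : g ∈ linkWeights w cap S) (hgS : degree ∅ g = linkValue w cap S)
    (hS : linkValue w cap S ≤ cap 0 / 2) (hv : v ∉ S) :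
    degree {v} (lightPart w cap g) ≤ linkValue w cap (insert v S) - linkValue w cap S := by
  have hle := degree_empty_le_linkValue hw hcap
    (add_link_lightPart_mem_linkWeights hw hdeg hg (hgS.trans_le hS) hv)
  rw [map_add, degree_link_of_notMem (notMem_empty v), insert_empty_eq, hgS] at hle
  linarith

theorem degree_sub_degree_lightPart_le_sum (hw : 0 ≤ w) (cap : ℕ → ℝ) (g : Finset α → ℝ) :
    degree ∅ w - degree ∅ (lightPart w cap g) ≤
      ∑ X : Finset α with X.Nonempty ∧ cap #X / 2 < degree X g, degree X w := by
  set heavy : Finset (Finset α) := {X | X.Nonempty ∧ cap #X / 2 < degree X g}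
  rw [degree_empty, degree_empty, ← sum_sub_distrib]
  simp only [degree_apply, sum_filter]
  rw [sum_comm]
  refine sum_le_sum fun A _ => ?_
  have hterm : ∀ X : Finset α, 0 ≤ if X ⊆ A then w A else 0 := fun X => by
    split_ifs
    exacts [hw A, le_rfl]
  by_cases hA : ∀ X ⊆ A, X.Nonempty → degree X g ≤ cap #X / 2
  · rw [lightPart, Set.indicator_of_mem (Set.mem_ofPred.2 hA), sub_self]
    exact sum_nonneg fun X _ => hterm X
  · rw [lightPart, Set.indicator_of_notMem (mt Set.mem_ofPred.1 hA), sub_zero]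
    push Not at hA
    obtain ⟨X, hXA, hX⟩ := hA
    simpa [hXA] using single_le_sum (fun X _ => hterm X) (mem_filter.2 ⟨mem_univ X, hX⟩)

/-- An edge that is not light contains a set `X` whose degree in `g` is at least `p` times its
degree in `w`, and each edge of `g` is counted for at most `2 ^ k` sets `X`. -/
theorem mul_degree_sub_degree_lightPart_le {p : ℝ} {k : ℕ} (hp : 0 ≤ p) (hw : 0 ≤ w) (hg : 0 ≤ g)
    (hrank : ∀ A, g A ≠ 0 → #A ≤ k)
    (hdeg : ∀ X : Finset α, X.Nonempty → p * degree X w ≤ cap #X / 2) :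
    p * (degree ∅ w - degree ∅ (lightPart w cap g)) ≤ 2 ^ k * degree ∅ g := by
  set heavy : Finset (Finset α) := {X | X.Nonempty ∧ cap #X / 2 < degree X g}
  calc p * (degree ∅ w - degree ∅ (lightPart w cap g))
      ≤ p * ∑ X ∈ heavy, degree X w :=
        mul_le_mul_of_nonneg_left (degree_sub_degree_lightPart_le_sum hw cap g) hp
    _ = ∑ X ∈ heavy, p * degree X w := mul_sum _ _ _
    _ ≤ ∑ X ∈ heavy, degree X g := sum_le_sum fun X hX =>
        (hdeg X (mem_filter.1 hX).2.1).trans (mem_filter.1 hX).2.2.le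
    _ ≤ ∑ X, degree X g :=
        sum_le_sum_of_subset_of_nonneg (subset_univ _) fun X _ _ => degree_nonneg X hg
    _ = ∑ A, 2 ^ #A * g A := sum_degree g
    _ ≤ ∑ A, 2 ^ k * g A := sum_le_sum fun A _ => by
        rcases eq_or_ne (g A) 0 with h | h
        · simp [h]
        · exact mul_le_mul_of_nonneg_right (pow_le_pow_right₀ one_le_two (hrank A h)) (hg A)
    _ = 2 ^ k * degree ∅ g := by rw [← mul_sum, degree_empty]

end LinkWeights

section Spread

variable {α : Type*} [Fintype α] {w : Finset α → ℝ} {X : Finset α} {c K p : ℝ}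

/-- The weighted hypergraph `w` is spread with constant `K` at density `p`: each vertex has degree
at most `K` times the total weight divided by the number of vertices, and each further vertex
lowers the bound on the degree by a factor `p`. -/
def IsSpread [DecidableEq α] (K p : ℝ) (w : Finset α → ℝ) : Prop :=
  ∀ X : Finset α, X.Nonempty →
    degree X w * Fintype.card α ≤ K * p ^ (#X - 1) * degree ∅ w

/-- The bound on the degrees of `j`-sets in the links that the container algorithm for `w`
accumulates. -/
noncomputable def capacity [DecidableEq α] (c K p : ℝ) (w : Finset α → ℝ) : ℕ → ℝ
  | 0 => c * p * degree ∅ w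
  | j + 1 => 2 * K * p ^ (j + 1) * degree ∅ w / Fintype.card α

variable [DecidableEq α]

theorem capacity_nonneg (hc : 0 ≤ c) (hK : 0 ≤ K) (hp : 0 ≤ p) (hw : 0 ≤ w) (j : ℕ) :
    0 ≤ capacity c K p w j := by
  have := degree_nonneg ∅ hw
  cases j <;> simp only [capacity] <;> positivity

theorem IsSpread.degree_le_capacity [Nonempty α] (hspread : IsSpread K p w) (hw : 0 ≤ w)
    (hM : 2 * K ≤ c * (p * Fintype.card α)) (hX : X.Nonempty) :
    degree X w ≤ capacity c K p w (#X - 1) / 2 := by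
  have hN : (0 : ℝ) < Fintype.card α := Nat.cast_pos.2 Fintype.card_pos
  refine ((le_div_iff₀ hN).2 (hspread X hX)).trans ?_
  rcases #X - 1 with - | j
  · rw [capacity, div_le_iff₀ hN]
    linarith [mul_le_mul_of_nonneg_right hM (degree_nonneg ∅ hw)]
  · exact le_of_eq (by rw [capacity]; ring)

theorem IsSpread.mul_degree_le_capacity [Nonempty α] (hspread : IsSpread K p w) (hp : 0 ≤ p)
    (hX : X.Nonempty) : p * degree X w ≤ capacity c K p w #X / 2 := by
  have hN : (0 : ℝ) < Fintype.card α := Nat.cast_pos.2 Fintype.card_pos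
  obtain ⟨j, hj⟩ := Nat.exists_eq_add_one.2 hX.card_pos
  have hdeg := hspread X hX
  rw [hj, Nat.add_sub_cancel] at hdeg
  rw [hj, capacity]
  calc p * degree X w ≤ p * (K * p ^ j * degree ∅ w / Fintype.card α) :=
        mul_le_mul_of_nonneg_left ((le_div_iff₀ hN).2 hdeg) hp
    _ = 2 * K * p ^ (j + 1) * degree ∅ w / Fintype.card α / 2 := by ring

end Spread

section Container

variable {α : Type*} [Fintype α] [DecidableEq α] {l : Finset α → ℝ} {K : ℝ} {S : Finset α}

/-- The container of the fingerprint `S` for the progress function `F`: the vertices whose addition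
to `S` increases `F` by at most `t`. -/
noncomputable def container (F : Finset α → ℝ) (t : ℝ) (S : Finset α) : Finset α :=
  {v | F (insert v S) ≤ F S + t}

theorem exists_fingerprint (F : Finset α → ℝ) {t : ℝ} (ht : 0 ≤ t) (I : Finset α) :
    ∃ S ⊆ I, F ∅ + t * #S ≤ F S ∧ I ⊆ container F t S := by
  obtain ⟨S, hS, hmax⟩ := exists_max_image I.powerset (fun S => F S - t * #S)
    ⟨∅, empty_mem_powerset I⟩
  rw [mem_powerset] at hS
  refine ⟨S, hS, ?_, fun v hv => mem_filter.2 ⟨mem_univ v, ?_⟩⟩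
  · have h := hmax ∅ (empty_mem_powerset I)
    simp only [card_empty, Nat.cast_zero, mul_zero, sub_zero] at h
    linarith
  · by_cases hvS : v ∈ S
    · rw [insert_eq_of_mem hvS]
      linarith
    · have h := hmax (insert v S) (mem_powerset.2 (insert_subset hv hS))
      simp only [card_insert_of_notMem hvS, Nat.cast_add, Nat.cast_one] at h
      linarith

theorem degree_empty_le_sum_degree_singleton (hl : 0 ≤ l) (hl0 : l ∅ = 0) :
    degree ∅ l ≤ ∑ v, degree {v} l := by
  rw [sum_degree_singleton, degree_empty]
  refine sum_le_sum fun A _ => ?_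
  rcases A.eq_empty_or_nonempty with rfl | hA
  · simp [hl0]
  · exact le_mul_of_one_le_left (hl A) (mod_cast hA.card_pos)

theorem card_le_of_sum_degree_le [Nonempty α] {C : Finset α} {W : ℝ} (hK : 0 < K) (hW : 0 < W)
    (hl : 0 ≤ l) (hl0 : l ∅ = 0) (hdeg : ∀ v, degree {v} l * Fintype.card α ≤ K * W)
    (hC : ∑ v ∈ C, degree {v} l + W / 2 ≤ degree ∅ l) :
    (#C : ℝ) ≤ (1 - 1 / (2 * K)) * Fintype.card α := by
  have hN : (0 : ℝ) < Fintype.card α := Nat.cast_pos.2 Fintype.card_pos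
  have hcompl : ∑ v ∈ Cᶜ, degree {v} l ≤ #Cᶜ * (K * W / Fintype.card α) := by
    rw [← nsmul_eq_mul]
    exact sum_le_card_nsmul _ _ _ fun v _ => (le_div_iff₀ hN).2 (hdeg v)
  have hhalf : W / 2 ≤ #Cᶜ * (K * W / Fintype.card α) := by
    linarith [degree_empty_le_sum_degree_singleton hl hl0,
      sum_add_sum_compl C fun v => degree {v} l]
  rw [card_compl, Nat.cast_sub (card_le_univ C), ← mul_div_assoc, le_div_iff₀ hN] at hhalf
  have hcard : (Fintype.card α : ℝ) ≤ (Fintype.card α - #C) * (2 * K) :=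
    le_of_mul_le_mul_left (by linarith) hW
  rw [sub_mul, one_mul, le_sub_comm, one_div_mul_eq_div, div_le_iff₀ (by positivity)]
  exact hcard

theorem sum_container_le {F : Finset α → ℝ} {t : ℝ} {d : α → ℝ} {D : ℝ} (hd : 0 ≤ d)
    (hD : ∀ v ∈ S, d v ≤ D) (ht : 0 ≤ t) (hgain : ∀ v ∉ S, d v ≤ F (insert v S) - F S) :
    ∑ v ∈ container F t S, d v ≤ #S * D + Fintype.card α * t := by
  have hnew : ∑ v ∈ container F t S \ S, d v ≤ Fintype.card α * t := by
    calc ∑ v ∈ container F t S \ S, d v ≤ #(container F t S \ S) • t :=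
          sum_le_card_nsmul _ _ _ fun v hv => by
            obtain ⟨hvC, hvS⟩ := mem_sdiff.1 hv
            linarith [hgain v hvS, (mem_filter.1 hvC).2]
      _ ≤ Fintype.card α * t := by
          rw [nsmul_eq_mul]
          exact mul_le_mul_of_nonneg_right (mod_cast card_le_univ _) ht
  have hold : ∑ v ∈ S, d v ≤ #S * D := by
    rw [← nsmul_eq_mul]
    exact sum_le_card_nsmul _ _ _ hD
  calc ∑ v ∈ container F t S, d v ≤ ∑ v ∈ S ∪ container F t S \ S, d v :=
        sum_le_sum_of_subset_of_nonneg (by rw [union_sdiff_self_eq_union]; exact subset_union_right)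
          fun v _ _ => hd v
    _ = ∑ v ∈ S, d v + ∑ v ∈ container F t S \ S, d v := sum_union disjoint_sdiff
    _ ≤ #S * D + Fintype.card α * t := add_le_add hold hnew

end Container

theorem mul_le_of_two_pow_mul_le_one {x : ℝ} {k : ℕ} (hx : 0 ≤ x) (h : 2 ^ (k + 4) * x ≤ 1) :
    16 * x ≤ 1 := by
  rw [pow_add] at h
  linarith [mul_le_mul_of_nonneg_right (one_le_pow₀ (n := k) (one_le_two (α := ℝ))) hx]

theorem card_mul_le_of_div_mul_card_le {α : Type*} [Fintype α] [Nonempty α] {S : Finset α}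
    {W y : ℝ} (h : W / (4 * Fintype.card α) * #S ≤ y) : #S * W ≤ 4 * Fintype.card α * y := by
  have hN : (0 : ℝ) < Fintype.card α := Nat.cast_pos.2 Fintype.card_pos
  rw [div_mul_eq_mul_div, div_le_iff₀ (by positivity)] at h
  linarith

section ContainerStep

variable {α : Type*} [Fintype α] [DecidableEq α] [Nonempty α] {w : Finset α → ℝ} {c K p : ℝ}
  {k : ℕ} {S : Finset α}

theorem degree_sub_degree_lightPart_le {g : Finset α → ℝ} (hp : 0 < p) (hw : 0 ≤ w)
    (hrank : ∀ A, w A ≠ 0 → #A ≤ k + 1) (hspread : IsSpread K p w) (hc : 2 ^ (k + 4) * c ≤ 1)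
    (hg : 0 ≤ g) (hgS : g ≤ link S w) (hsmall : degree ∅ g ≤ capacity c K p w 0 / 2) :
    degree ∅ w - degree ∅ (lightPart w (capacity c K p w) g) ≤ degree ∅ w / 32 := by
  have hremoved := mul_degree_sub_degree_lightPart_le hp.le hw hg
    (fun B => card_le_of_le_link hg hgS hrank)
    fun X hX => hspread.mul_degree_le_capacity (c := c) hp.le hX
  refine le_of_mul_le_mul_left (hremoved.trans ?_) hp
  calc 2 ^ k * degree ∅ g ≤ 2 ^ k * (c * p * degree ∅ w / 2) :=
        mul_le_mul_of_nonneg_left hsmall (by positivity)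
    _ = 2 ^ (k + 4) * c * (p * (degree ∅ w / 32)) := by ring
    _ ≤ 1 * (p * (degree ∅ w / 32)) :=
        mul_le_mul_of_nonneg_right hc (by have := degree_nonneg ∅ hw; positivity)
    _ = p * (degree ∅ w / 32) := one_mul _

theorem card_mul_degree_bound_le (hK : 0 ≤ K) (hp : 0 ≤ p) (hp1 : p ≤ 1)
    (hw : 0 ≤ w) (hcK : 16 * (c * K) ≤ 1)
    (hS : degree ∅ w / (4 * Fintype.card α) * #S ≤ capacity c K p w 0 / 2) :
    #S * (K * degree ∅ w / Fintype.card α) ≤ degree ∅ w / 8 := by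
  have hW := degree_nonneg ∅ hw
  calc #S * (K * degree ∅ w / Fintype.card α) = K / Fintype.card α * (#S * degree ∅ w) := by ring
    _ ≤ K / Fintype.card α * (4 * Fintype.card α * (capacity c K p w 0 / 2)) :=
        mul_le_mul_of_nonneg_left (card_mul_le_of_div_mul_card_le hS) (by positivity)
    _ = 16 * (c * K) * p * (degree ∅ w / 8) := by rw [capacity]; field_simp; ring
    _ ≤ degree ∅ w / 8 := mul_le_of_le_one_left (by positivity) (mul_le_one₀ hcK hp hp1)

theorem card_container_le_of_linkValue_le (hK : 1 ≤ K) (hp : 0 < p) (hp1 : p ≤ 1) (hw : 0 ≤ w)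
    (hw0 : w ∅ = 0) (hW : 0 < degree ∅ w) (hrank : ∀ A, w A ≠ 0 → #A ≤ k + 1)
    (hspread : IsSpread K p w) (hc : 0 < c) (hcK : 2 ^ (k + 4) * (c * K) ≤ 1)
    (hM : 2 * K ≤ c * (p * Fintype.card α))
    (hS : degree ∅ w / (4 * Fintype.card α) * #S ≤ linkValue w (capacity c K p w) S)
    (hsmall : linkValue w (capacity c K p w) S ≤ capacity c K p w 0 / 2) :
    (#(container (linkValue w (capacity c K p w)) (degree ∅ w / (4 * Fintype.card α)) S) : ℝ) ≤
      (1 - 1 / (2 * K)) * Fintype.card α := by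
  have hN : (0 : ℝ) < Fintype.card α := Nat.cast_pos.2 Fintype.card_pos
  have hcap : ∀ j, 0 ≤ capacity c K p w j := capacity_nonneg hc.le (by linarith) hp.le hw
  obtain ⟨g, hg, hgS⟩ := exists_degree_empty_eq_linkValue hw hcap S
  set l := lightPart w (capacity c K p w) g
  have hl0 : 0 ≤ l := lightPart_nonneg hw _ _
  have hlw : l ≤ w := lightPart_le hw _ _
  have hremoved : degree ∅ w - degree ∅ l ≤ degree ∅ w / 32 := by
    refine degree_sub_degree_lightPart_le hp hw hrank hspread ?_ hg.1.1 hg.1.2 (hgS.trans_le hsmall)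
    exact (mul_le_mul_of_nonneg_left (le_mul_of_one_le_right hc.le hK) (by positivity)).trans hcK
  have hdeg : ∀ v, degree {v} l * Fintype.card α ≤ K * degree ∅ w := fun v =>
    (mul_le_mul_of_nonneg_right (degree_mono _ hlw) hN.le).trans
      (by simpa using hspread {v} (singleton_nonempty v))
  have hsum := sum_container_le (S := S) (d := fun v => degree {v} l)
    (fun v => degree_nonneg _ hl0) (fun v _ => (le_div_iff₀ hN).2 (hdeg v))
    (t := degree ∅ w / (4 * Fintype.card α)) (by positivity) fun v hv =>
    degree_lightPart_le_linkValue_sub hw hcap (fun X => hspread.degree_le_capacity hw hM) hg hgS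
      hsmall hv
  have hold : #S * (K * degree ∅ w / Fintype.card α) ≤ degree ∅ w / 8 :=
    card_mul_degree_bound_le (by linarith) hp.le hp1 hw
      (mul_le_of_two_pow_mul_le_one (by positivity) hcK) (hS.trans hsmall)
  have hnew : Fintype.card α * (degree ∅ w / (4 * Fintype.card α)) = degree ∅ w / 4 := by
    field_simp
  exact card_le_of_sum_degree_le (by linarith) hW hl0 (le_antisymm (hw0 ▸ hlw ∅) (hl0 ∅)) hdeg
    (by linarith)

theorem isSpread_of_mem_linkWeights {g : Finset α → ℝ} (hK : 0 ≤ K) (hp : 0 ≤ p) (hc : 0 < c)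
    (hg : g ∈ linkWeights w (capacity c K p w) S) (hlarge : capacity c K p w 0 / 2 ≤ degree ∅ g) :
    IsSpread (4 * K / c) p g := by
  have hN : (0 : ℝ) < Fintype.card α := Nat.cast_pos.2 Fintype.card_pos
  intro X hX
  have hdeg := hg.2 X
  obtain ⟨j, hj⟩ := Nat.exists_eq_add_one.2 hX.card_pos
  rw [hj, capacity, le_div_iff₀ hN] at hdeg
  rw [hj, Nat.add_sub_cancel]
  calc degree X g * Fintype.card α ≤ 2 * K * p ^ (j + 1) * degree ∅ w := hdeg
    _ = 4 * K / c * p ^ j * (capacity c K p w 0 / 2) := by rw [capacity]; field_simp; ring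
    _ ≤ 4 * K / c * p ^ j * degree ∅ g := mul_le_mul_of_nonneg_left hlarge (by positivity)

/-- One round of the container algorithm: a fingerprint `S` either has a small container, or it
comes with a spread hypergraph of smaller rank all of whose edges extend to edges of `w` by a vertex
of `S`. -/
theorem exists_fingerprints (hK : 1 ≤ K) (hp : 0 < p) (hp1 : p ≤ 1) (hw : 0 ≤ w)
    (hw0 : w ∅ = 0) (hW : 0 < degree ∅ w) (hrank : ∀ A, w A ≠ 0 → #A ≤ k + 1)
    (hspread : IsSpread K p w) (hc : 0 < c) (hcK : 2 ^ (k + 4) * (c * K) ≤ 1)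
    (hM : 2 * K ≤ c * (p * Fintype.card α)) :
    ∃ (𝒮 : Finset (Finset α)) (C : Finset α → Finset α), (∀ I, ∃ S ∈ 𝒮, S ⊆ I ∧ I ⊆ C S) ∧
      ∀ S ∈ 𝒮, #S ≤ p * Fintype.card α ∧ ((#(C S) : ℝ) ≤ (1 - 1 / (2 * K)) * Fintype.card α ∨
        ∃ g, 0 ≤ g ∧ g ≤ link S w ∧ 0 < degree ∅ g ∧ IsSpread (4 * K / c) p g) := by
  classical
  have hN : (0 : ℝ) < Fintype.card α := Nat.cast_pos.2 Fintype.card_pos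
  have hcap : ∀ j, 0 ≤ capacity c K p w j := capacity_nonneg hc.le (by linarith) hp.le hw
  set F := linkValue w (capacity c K p w) with hF
  set t := degree ∅ w / (4 * Fintype.card α) with ht
  refine ⟨({S | t * #S ≤ F S} : Finset _), container F t, fun I => ?_, fun S hS => ?_⟩
  · obtain ⟨S, hSI, hS, hIS⟩ := exists_fingerprint F (t := t) (by positivity) I
    refine ⟨S, mem_filter.2 ⟨mem_univ S, ?_⟩, hSI, hIS⟩
    linarith [linkValue_nonneg hw hcap ∅]
  have hS : t * #S ≤ F S := (mem_filter.1 hS).2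
  constructor
  · have hcard := card_mul_le_of_div_mul_card_le (hS.trans (linkValue_le hw hcap S))
    have hc1 : 4 * c ≤ 1 := by
      linarith [le_mul_of_one_le_right hc.le hK, mul_le_of_two_pow_mul_le_one (by positivity) hcK]
    refine le_of_mul_le_mul_right (hcard.trans ?_) hW
    calc 4 * Fintype.card α * capacity c K p w 0
        = 4 * c * (p * Fintype.card α * degree ∅ w) := by rw [capacity]; ring
      _ ≤ p * Fintype.card α * degree ∅ w := mul_le_of_le_one_left (by positivity) hc1
  · rcases le_or_gt (F S) (capacity c K p w 0 / 2) with hsmall | hlarge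
    · exact .inl <| card_container_le_of_linkValue_le hK hp hp1 hw hw0 hW hrank hspread hc hcK hM
        hS hsmall
    · obtain ⟨g, hg, hgS⟩ := exists_degree_empty_eq_linkValue hw hcap S
      rw [← hF] at hgS
      exact .inr ⟨g, hg.1.1, hg.1.2, hgS ▸ (div_nonneg (hcap 0) two_pos.le).trans_lt hlarge,
        isSpread_of_mem_linkWeights (by linarith) hp.le hc hg (hgS ▸ hlarge.le)⟩

end ContainerStep

section Containers

variable {α : Type*} [Fintype α] {w : Finset α → ℝ}

/-- The weighted hypergraph `w` has at most `b` containers: there are at most `b` vertex sets, each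
without a proportion `δ` of the vertices, such that each independent set of `w` is contained in one
of them. -/
def HasContainers (b : ℕ) (δ : ℝ) (w : Finset α → ℝ) : Prop :=
  ∃ 𝒞 : Finset (Finset α), #𝒞 ≤ b ∧ (∀ C ∈ 𝒞, (#C : ℝ) ≤ (1 - δ) * Fintype.card α) ∧
    ∀ I, (∀ A ⊆ I, w A = 0) → ∃ C ∈ 𝒞, I ⊆ C

theorem HasContainers.mono {b b' : ℕ} {δ δ' : ℝ} (hb : b ≤ b') (hδ : δ' ≤ δ)
    (h : HasContainers b δ w) : HasContainers b' δ' w :=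
  h.imp fun _ h𝒞 => ⟨h𝒞.1.trans hb, fun C hC => (h𝒞.2.1 C hC).trans (by gcongr), h𝒞.2.2⟩

theorem hasContainers_of_apply_empty_ne_zero (h : w ∅ ≠ 0) (b : ℕ) (δ : ℝ) :
    HasContainers b δ w :=
  ⟨∅, by simp, by simp, fun I hI => absurd (hI ∅ (empty_subset I)) h⟩

theorem hasContainers_of_fingerprints [DecidableEq α] {𝒮 : Finset (Finset α)}
    {C : Finset α → Finset α} {b : ℕ} {δ : ℝ} (hb : 1 ≤ b) (hcover : ∀ I, ∃ S ∈ 𝒮, S ⊆ I ∧ I ⊆ C S)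
    (h𝒮 : ∀ S ∈ 𝒮, (#(C S) : ℝ) ≤ (1 - δ) * Fintype.card α ∨
      ∃ g, 0 ≤ g ∧ g ≤ link S w ∧ HasContainers b δ g) :
    HasContainers (#𝒮 * b) δ w := by
  have hlocal : ∀ S ∈ 𝒮, ∃ 𝒞 : Finset (Finset α), #𝒞 ≤ b ∧
      (∀ D ∈ 𝒞, (#D : ℝ) ≤ (1 - δ) * Fintype.card α) ∧
      ∀ I, (∀ A ⊆ I, w A = 0) → S ⊆ I → I ⊆ C S → ∃ D ∈ 𝒞, I ⊆ D := fun S hS => by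
    rcases h𝒮 S hS with hsmall | ⟨g, hg, hgS, 𝒞, hcard, hδ, hcov⟩
    · exact ⟨{C S}, (card_singleton _).trans_le hb, by simpa using hsmall,
        fun I _ _ hIC => ⟨C S, mem_singleton_self _, hIC⟩⟩
    · refine ⟨𝒞, hcard, hδ, fun I hI hSI _ => hcov I fun B hB => ?_⟩
      by_contra hne
      obtain ⟨v, hv, hvB⟩ := exists_insert_ne_zero_of_le_link hg hgS hne
      exact hvB (hI _ (insert_subset (hSI (mem_sdiff.1 hv).1) hB))
  choose! 𝒞 hcard hδ hcov using hlocal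
  refine ⟨𝒮.biUnion 𝒞, card_biUnion_le_card_mul _ _ _ hcard, fun D hD => ?_, fun I hI => ?_⟩
  · obtain ⟨S, hS, hDS⟩ := mem_biUnion.1 hD
    exact hδ S hS D hDS
  · obtain ⟨S, hS, hSI, hIC⟩ := hcover I
    obtain ⟨D, hD, hID⟩ := hcov S hS I hI hSI hIC
    exact ⟨D, mem_biUnion.2 ⟨S, hS, hD⟩, hID⟩

theorem hasContainers_of_isSpread [DecidableEq α] {c K p δ : ℝ} {k : ℕ} (hK : 1 ≤ K) (hp : 0 < p)
    (hp1 : p ≤ 1) (hw : 0 ≤ w) (hW : 0 < degree ∅ w) (hrank : ∀ A, w A ≠ 0 → #A ≤ k + 1)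
    (hspread : IsSpread K p w) (hc : 0 < c) (hcK : 2 ^ (k + 4) * (c * K) ≤ 1)
    (hM : 2 * K ≤ c * (p * Fintype.card α)) (hδ : δ ≤ 1 / (2 * K))
    (ih : ∀ g : Finset α → ℝ, 0 ≤ g → 0 < degree ∅ g → (∀ B, g B ≠ 0 → #B ≤ k) →
      IsSpread (4 * K / c) p g →
      HasContainers (#{S : Finset α | #S ≤ p * Fintype.card α} ^ k) δ g) :
    HasContainers (#{S : Finset α | #S ≤ p * Fintype.card α} ^ (k + 1)) δ w := by
  by_cases hw0 : w ∅ = 0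
  swap
  · exact hasContainers_of_apply_empty_ne_zero hw0 _ _
  have hne : Nonempty α := Fintype.card_pos_iff.1 <| Nat.pos_of_ne_zero fun h => by
    rw [h, Nat.cast_zero, mul_zero, mul_zero] at hM
    linarith
  obtain ⟨𝒮, C, hcover, h𝒮⟩ := exists_fingerprints hK hp hp1 hw hw0 hW hrank hspread hc hcK hM
  set b := #{S : Finset α | #S ≤ p * Fintype.card α}
  have hb1 : 1 ≤ b := card_pos.2 ⟨∅, mem_filter.2 ⟨mem_univ ∅, by
    rw [card_empty, Nat.cast_zero]
    positivity⟩⟩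
  have h𝒮b : #𝒮 ≤ b := card_le_card fun S hS => mem_filter.2 ⟨mem_univ S, (h𝒮 S hS).1⟩
  refine (hasContainers_of_fingerprints (Nat.one_le_pow k _ hb1) hcover
    fun S hS => (h𝒮 S hS).2.imp (fun hsmall => ?_) ?_).mono
    ((Nat.mul_le_mul_right _ h𝒮b).trans_eq (pow_succ' _ _).symm) le_rfl
  · exact hsmall.trans (by gcongr)
  · rintro ⟨g, hg, hgS, hgW, hgspread⟩
    exact ⟨g, hg, hgS, ih g hg hgW (fun B => card_le_of_le_link hg hgS hrank) hgspread⟩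

theorem exists_hasContainers.{u} (k : ℕ) (K : ℝ) (hK : 1 ≤ K) :
    ∃ δ : ℝ, 0 < δ ∧ ∃ M : ℝ, ∀ (α : Type u) [Fintype α] [DecidableEq α] (p : ℝ)
      (w : Finset α → ℝ), 0 < p → p ≤ 1 → M ≤ p * Fintype.card α → 0 ≤ w → 0 < degree ∅ w →
      (∀ A, w A ≠ 0 → #A ≤ k) → IsSpread K p w →
      HasContainers (#{S : Finset α | #S ≤ p * Fintype.card α} ^ k) δ w := by
  induction k generalizing K with
  | zero =>
    refine ⟨1, one_pos, 0, fun α _ _ p w _ _ _ _ hW hrank _ => ?_⟩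
    obtain ⟨A, -, hA⟩ := exists_ne_zero_of_sum_ne_zero (degree_empty w ▸ hW.ne')
    rw [card_eq_zero.1 (Nat.le_zero.1 (hrank A hA))] at hA
    exact hasContainers_of_apply_empty_ne_zero hA _ _
  | succ k ih =>
    set c : ℝ := 1 / (2 ^ (k + 4) * K) with hc
    have hc0 : 0 < c := by positivity
    have hcK : 2 ^ (k + 4) * (c * K) ≤ 1 := by rw [hc]; exact le_of_eq (by field_simp)
    have hc1 := mul_le_of_two_pow_mul_le_one (by positivity) hcK
    obtain ⟨δ, hδ, M, ih⟩ := ih (4 * K / c) ((one_le_div hc0).2 (by nlinarith))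
    refine ⟨min δ (1 / (2 * K)), by positivity, max M (2 * K / c),
      fun α _ _ p w hp hp1 hM hw hW hrank hspread => ?_⟩
    refine hasContainers_of_isSpread hK hp hp1 hw hW hrank hspread hc0 hcK ?_ (min_le_right _ _)
      fun g hg hgW hgrank hgspread => (ih α p g hp hp1 ((le_max_left _ _).trans hM) hg hgW hgrank
        hgspread).mono le_rfl (min_le_left _ _)
    rw [mul_comm c, ← div_le_iff₀ hc0]
    exact (le_max_right _ _).trans hM

theorem card_filter_card_le_exp (α : Type*) [Fintype α] {t r : ℝ} (ht : 1 ≤ t) :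
    (#{S : Finset α | #S ≤ r} : ℝ) ≤ Real.exp (r * Real.log t + Fintype.card α / t) := by
  have ht0 : 0 < t := by linarith
  have hterm : ∀ S ∈ ({S : Finset α | #S ≤ r} : Finset _), 1 ≤ t ^ r * (1 / t) ^ #S := by
    intro S hS
    rw [one_div, inv_pow, ← div_eq_mul_inv, one_le_div (by positivity), ← Real.rpow_natCast]
    exact Real.rpow_le_rpow_of_exponent_le ht (mem_filter.1 hS).2
  calc (#{S : Finset α | #S ≤ r} : ℝ) = ∑ S : Finset α with #S ≤ r, 1 := by simp
    _ ≤ ∑ S : Finset α with #S ≤ r, t ^ r * (1 / t) ^ #S := sum_le_sum hterm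
    _ ≤ ∑ S : Finset α, t ^ r * (1 / t) ^ #S :=
        sum_le_sum_of_subset_of_nonneg (filter_subset _ _) fun S _ _ => by positivity
    _ = t ^ r * (1 / t + 1) ^ Fintype.card α := by
        rw [← mul_sum, ← Fintype.sum_pow_mul_eq_add_pow]
        simp only [one_pow, mul_one]
    _ ≤ t ^ r * Real.exp (1 / t) ^ Fintype.card α := by
        gcongr
        exact Real.add_one_le_exp _
    _ = Real.exp (r * Real.log t + Fintype.card α / t) := by
        rw [← Real.exp_nat_mul, Real.rpow_def_of_pos ht0, ← Real.exp_add]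
        ring_nf

end Containers

theorem exists_saturating_packing {ι : Type*} [Fintype ι] [DecidableEq ι] (E : Finset (Finset ι))
    (hE : ∀ A ∈ E, A.Nonempty) {z : ι → ℝ} (hz : 0 ≤ z) :
    ∃ y : Finset ι → ℝ, 0 ≤ y ∧ (∀ A ∉ E, y A = 0) ∧ (∀ v, degree {v} y ≤ z v) ∧
      ∀ A ∈ E, ∃ v ∈ A, degree {v} y = z v := by
  induction E using Finset.induction_on with
  | empty => exact ⟨0, le_rfl, by simp, fun v => by simpa using hz v, by simp⟩
  | insert A E hA ih =>
    obtain ⟨y, hy, hsupp, hle, hsat⟩ := ih fun B hB => hE B (mem_insert_of_mem hB)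
    obtain ⟨u, hu, hmin⟩ :=
      exists_min_image A (fun v => z v - degree {v} y) (hE A (mem_insert_self A E))
    set r := z u - degree {u} y with hr
    have hr0 : 0 ≤ r := sub_nonneg.2 (hle u)
    have hdeg : ∀ v, degree {v} (y + Pi.single A r) = degree {v} y + if v ∈ A then r else 0 :=
      fun v => by rw [map_add, degree_single]; simp only [singleton_subset_iff]
    refine ⟨y + Pi.single A r, add_nonneg hy (Pi.single_nonneg.2 hr0), fun B hB => ?_,
      fun v => ?_, fun B hB => ?_⟩
    · rw [mem_insert, not_or] at hB
      rw [Pi.add_apply, hsupp B hB.2, Pi.single_eq_of_ne hB.1, add_zero]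
    · rw [hdeg]
      split_ifs with hv
      · linarith [hmin v hv]
      · linarith [hle v]
    · rcases mem_insert.1 hB with rfl | hB
      · exact ⟨u, hu, by rw [hdeg, if_pos hu]; ring⟩
      · obtain ⟨v, hv, hvz⟩ := hsat B hB
        refine ⟨v, hv, ?_⟩
        rw [hdeg]
        split_ifs with hvA
        · linarith [hmin v hvA]
        · rw [add_zero, hvz]

section Numberings

open Numbering

variable {X : Type*}

theorem isPrefix_trans_map [Fintype X] {f : Numbering X} {x : Finset X} (hf : f.IsPrefix x)
    (σ : Equiv.Perm X) :
    IsPrefix (σ.trans f : Numbering X) (x.map σ.symm.toEmbedding) := fun c => by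
  rw [mem_map_equiv, Equiv.symm_symm, hf, card_map, Equiv.trans_apply]

variable [DecidableEq X]

theorem map_swap_symm_of_notMem {x : Finset X} {a b : X} (ha : a ∉ x) (hb : b ∉ x) :
    x.map (Equiv.swap a b).symm.toEmbedding = x := by
  ext c
  rw [mem_map_equiv, Equiv.symm_symm, Equiv.swap_apply_def]
  split_ifs with hca hcb
  · simp [hca, ha, hb]
  · simp [hcb, ha, hb]
  · rfl

theorem eq_and_eq_of_map_swap_symm_eq {x : Finset X} {a b a' b' : X} (ha : a ∈ x) (hb : b ∉ x)
    (ha' : a' ∈ x) (hb' : b' ∉ x)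
    (h : x.map (Equiv.swap a b).symm.toEmbedding = x.map (Equiv.swap a' b').symm.toEmbedding) :
    a = a' ∧ b = b' := by
  have hswap : ∀ c, Equiv.swap a b c ∈ x ↔ Equiv.swap a' b' c ∈ x := fun c => by
    simpa only [mem_map_equiv, Equiv.symm_symm] using Finset.ext_iff.1 h c
  constructor
  · by_contra hne
    have hfix := hswap a
    rw [Equiv.swap_apply_left, Equiv.swap_apply_of_ne_of_ne hne (ne_of_mem_of_not_mem ha hb')]
      at hfix
    exact hb (hfix.2 ha)
  · by_contra hne
    have hfix := hswap b
    rw [Equiv.swap_apply_right, Equiv.swap_apply_of_ne_of_ne (ne_of_mem_of_not_mem ha' hb).symm hne]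
      at hfix
    exact hb (hfix.1 ha)

variable [Fintype X]

/-- The numberings of which all members of `s` are prefixes. They correspond to the maximal chains
of sets that contain `s`. -/
def commonPrefixed (s : Finset (Finset X)) : Finset (Numbering X) :=
  {f | ∀ x ∈ s, f.IsPrefix x}

theorem mem_commonPrefixed {s : Finset (Finset X)} {f : Numbering X} :
    f ∈ commonPrefixed s ↔ ∀ x ∈ s, f.IsPrefix x := by
  simp [commonPrefixed]

/-- Swapping a point of `y \ z` with a point outside `y` destroys the prefix `y` and keeps all
prefixes contained in `z`. The swap can be recovered from the new prefix of the size of `y`. -/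
theorem card_commonPrefixed_insert_mul_le {s : Finset (Finset X)} {y z : Finset X}
    (hs : ∀ u ∈ s, u ⊆ z) (hzy : z ⊆ y) :
    #(commonPrefixed (insert y s)) * (#(y \ z) * #yᶜ) ≤ #(commonPrefixed s) := by
  rw [← card_product, ← card_product]
  refine card_le_card_of_injOn (fun q => (Equiv.swap q.2.1 q.2.2).trans q.1) ?_ ?_
  · rintro ⟨f, a, b⟩ hq
    simp only [coe_product, Set.mem_prod, mem_coe, mem_commonPrefixed, mem_sdiff,
      mem_compl] at hq ⊢
    obtain ⟨hf, ⟨-, haz⟩, hby⟩ := hq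
    intro u hu
    rw [← map_swap_symm_of_notMem (fun h => haz (hs u hu h)) fun h => hby (hzy (hs u hu h))]
    exact isPrefix_trans_map (hf u (mem_insert_of_mem hu)) _
  · rintro ⟨f, a, b⟩ hq ⟨f', a', b'⟩ hq' heq
    simp only [coe_product, Set.mem_prod, mem_coe, mem_commonPrefixed, mem_sdiff,
      mem_compl] at hq hq' heq
    have hpre := isPrefix_trans_map (hq.1 y (mem_insert_self y s)) (Equiv.swap a b)
    have hpre' := isPrefix_trans_map (hq'.1 y (mem_insert_self y s)) (Equiv.swap a' b')
    rw [heq] at hpre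
    obtain ⟨rfl, rfl⟩ := eq_and_eq_of_map_swap_symm_eq hq.2.1.1 hq.2.2 hq'.2.1.1 hq'.2.2 <|
      (hpre.subset_of_card_le_card hpre' (by simp)).antisymm
        (hpre'.subset_of_card_le_card hpre (by simp))
    have hff' : f = f' := by
      ext c
      simpa using congrArg (fun e : Numbering X => (e (Equiv.swap a b c) : ℕ)) heq
    rw [hff']

theorem exists_card_commonPrefixed_mul_pow_le {s : Finset (Finset X)} (hs : s.Nonempty)
    (hchain : IsChain (· ⊆ ·) (s : Set (Finset X))) {r : ℝ} (hr : 0 ≤ r)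
    (hcompl : ∀ u ∈ s, r ≤ #uᶜ) :
    ∃ x ∈ s, #(commonPrefixed s) * r ^ (#s - 1) ≤ #(prefixed x) := by
  induction s using Finset.induction_on_max_value (fun u : Finset X => #u) with
  | empty => exact absurd hs not_nonempty_empty
  | insert y s hy hmax ih =>
    rcases s.eq_empty_or_nonempty with rfl | hs'
    · exact ⟨y, mem_insert_self y ∅, by simp [commonPrefixed, prefixed]⟩
    have hsub : ∀ u ∈ insert y s, ∀ v ∈ insert y s, #u ≤ #v → u ⊆ v := by
      intro u hu v hv huv
      rcases hchain.total hu hv with h | h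
      exacts [h, (eq_of_subset_of_card_le h huv).symm.subset]
    obtain ⟨z, hz, hzmax⟩ := exists_max_image s card hs'
    have hzy : z ⊆ y :=
      hsub z (mem_insert_of_mem hz) y (mem_insert_self y s) (hmax z hz)
    obtain ⟨x, hx, hxs⟩ := ih hs' (hchain.mono (by simp)) fun u hu =>
      hcompl u (mem_insert_of_mem hu)
    have hswap : (#(commonPrefixed (insert y s)) * (#(y \ z) * #yᶜ) : ℝ) ≤ #(commonPrefixed s) :=
      mod_cast card_commonPrefixed_insert_mul_le (fun u hu => hsub u (mem_insert_of_mem hu) z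
        (mem_insert_of_mem hz) (hzmax u hu)) hzy
    have hdiff : (1 : ℝ) ≤ #(y \ z) := mod_cast card_pos.2 (sdiff_nonempty.2 fun hyz =>
      hy (hyz.antisymm hzy ▸ hz))
    have hpair : r ≤ #(y \ z) * #yᶜ :=
      (hcompl y (mem_insert_self y s)).trans (le_mul_of_one_le_left (Nat.cast_nonneg _) hdiff)
    refine ⟨x, mem_insert_of_mem hx, ?_⟩
    calc #(commonPrefixed (insert y s)) * r ^ (#(insert y s) - 1)
        = #(commonPrefixed (insert y s)) * r * r ^ (#s - 1) := by
          rw [card_insert_of_notMem hy, mul_assoc, ← pow_succ', Nat.add_sub_cancel,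
            Nat.sub_add_cancel hs'.card_pos]
      _ ≤ #(commonPrefixed (insert y s)) * (#(y \ z) * #yᶜ) * r ^ (#s - 1) := by gcongr
      _ ≤ #(commonPrefixed s) * r ^ (#s - 1) := by gcongr
      _ ≤ #(prefixed x) := hxs

theorem card_prefixed_mul_choose (x : Finset X) :
    #(prefixed x) * (Fintype.card X).choose #x = (Fintype.card X).factorial := by
  rw [Numbering.card_prefixed, mul_comm, ← mul_assoc]
  exact Nat.choose_mul_factorial_mul_factorial (card_le_univ x)

end Numberings

section Templates

variable {n m : ℕ} {𝒢 : Finset (List (Fin m))} {T : Template n m} {β : Fin m → ℝ}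

/-- The pairs `(x, c)` with `c ∈ T x`. They are the vertices of the hypergraph to which the
container algorithm is applied. -/
abbrev Template.Vertex (T : Template n m) : Type :=
  Σ x, T x

/-- The edges of that hypergraph: the colored chains of `T` whose color sequence belongs to `𝒢`. -/
def Template.IsBadEdge (T : Template n m) (𝒢 : Finset (List (Fin m))) (A : Finset T.Vertex) :
    Prop :=
  ∃ g ∈ 𝒢, ∃ v : Fin g.length → T.Vertex, StrictMono (fun i => (v i).1) ∧
    (∀ i, ((v i).2 : Fin m) = g.get i) ∧ A = univ.image v

/-- The sub-template of `T` that consists of the vertices in `D`. -/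
def Template.restrict (T : Template n m) (D : Finset T.Vertex) : Template n m :=
  fun x => {c | ∃ h : c ∈ T x, ⟨x, c, h⟩ ∈ D}

theorem Template.IsBadEdge.exists_card_eq {A : Finset T.Vertex} (hA : T.IsBadEdge 𝒢 A) :
    ∃ g ∈ 𝒢, #A = g.length := by
  obtain ⟨g, hg, v, hv, -, rfl⟩ := hA
  have hinj : Function.Injective v := .of_comp (f := Sigma.fst) hv.injective
  exact ⟨g, hg, by rw [card_image_of_injective _ hinj, card_univ, Fintype.card_fin]⟩

theorem Template.IsBadEdge.card_le {A : Finset T.Vertex} (hA : T.IsBadEdge 𝒢 A) :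
    #A ≤ 𝒢.sup List.length := by
  obtain ⟨g, hg, hcard⟩ := hA.exists_card_eq
  exact hcard.trans_le (le_sup (f := List.length) hg)

theorem Template.IsBadEdge.isChain_image_fst {A : Finset T.Vertex} (hA : T.IsBadEdge 𝒢 A) :
    IsChain (· ⊆ ·) (Sigma.fst '' (A : Set T.Vertex)) := by
  obtain ⟨g, -, v, hv, -, rfl⟩ := hA
  rw [coe_image, coe_univ, Set.image_univ, ← Set.range_comp]
  exact hv.monotone.isChain_range

theorem Template.IsBadEdge.injOn_fst {A : Finset T.Vertex} (hA : T.IsBadEdge 𝒢 A) :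
    Set.InjOn Sigma.fst (A : Set T.Vertex) := by
  obtain ⟨g, -, v, hv, -, rfl⟩ := hA
  rw [coe_image, coe_univ, Set.image_univ]
  rintro _ ⟨i, rfl⟩ _ ⟨j, rfl⟩ h
  rw [hv.injective h]

theorem Template.mem_supp {x : Finset (Fin n)} : x ∈ T.supp ↔ (T x).Nonempty := by
  simp [Template.supp]

theorem Template.Vertex.fst_mem_supp (v : T.Vertex) : v.1 ∈ T.supp :=
  Template.mem_supp.2 ⟨v.2, v.2.2⟩

theorem Template.mem_restrict {D : Finset T.Vertex} {x : Finset (Fin n)} {c : Fin m} :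
    c ∈ T.restrict D x ↔ ∃ h : c ∈ T x, ⟨x, c, h⟩ ∈ D := by
  simp [Template.restrict]

theorem Template.restrict_le (D : Finset T.Vertex) : T.restrict D ≤ T :=
  fun _ _ hc => (Template.mem_restrict.1 hc).1

theorem Template.sum_restrict {M : Type*} [AddCommMonoid M] (D : Finset T.Vertex)
    (x : Finset (Fin n)) (f : Fin m → M) :
    ∑ i ∈ T.restrict D x, f i = ∑ c : T x, if ⟨x, c⟩ ∈ D then f c else 0 := by
  rw [← sum_filter]
  refine sum_bij' (fun i hi => ⟨i, (Template.mem_restrict.1 hi).1⟩) (fun c _ => c) ?_ ?_ ?_ ?_ ?_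
  · exact fun i hi => mem_filter.2 ⟨mem_univ _, (Template.mem_restrict.1 hi).2⟩
  · exact fun c hc => Template.mem_restrict.2 ⟨c.2, (mem_filter.1 hc).2⟩
  all_goals simp

theorem Template.size_restrict (D : Finset T.Vertex) : (T.restrict D).size = #D := by
  simp only [Template.size, card_eq_sum_ones, Template.sum_restrict]
  rw [← Fintype.sum_sigma fun v : T.Vertex => if v ∈ D then 1 else 0, sum_ite_mem, univ_inter]

theorem Template.card_vertex (T : Template n m) : Fintype.card T.Vertex = T.size := by
  simp [Template.size]

theorem Template.IsFullColoring.containedIn {S : ColoredSubset n m} (hS : T.IsFullColoring S) :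
    S.ContainedIn T := by
  intro x c hx
  by_cases hxT : x ∈ T.supp
  · obtain ⟨c', hc', hSc'⟩ := hS.1 x hxT
    rwa [Option.some_inj.1 (hx.symm.trans hSc')]
  · rw [hS.2 x hxT] at hx
    exact absurd hx (by simp)

theorem valid_of_containedIn_restrict {D : Finset T.Vertex} (hD : ∀ A ⊆ D, ¬ T.IsBadEdge 𝒢 A)
    {S : ColoredSubset n m} (hS : S.ContainedIn (T.restrict D)) : S.Valid 𝒢 := by
  rintro g hg ⟨x, hx, hSx⟩
  choose hT hxD using fun i => Template.mem_restrict.1 (hS _ _ (hSx i))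
  refine hD (univ.image fun i => ⟨x i, g.get i, hT i⟩) ?_ ⟨g, hg, _, hx, fun i => rfl, rfl⟩
  exact image_subset_iff.2 fun i _ => hxD i

theorem exists_mem_ne_of_valid {S : ColoredSubset n m} (hS : S.Valid 𝒢) {A : Finset T.Vertex}
    (hA : T.IsBadEdge 𝒢 A) : ∃ v ∈ A, S v.1 ≠ some v.2.1 := by
  obtain ⟨g, hg, v, hv, hcol, rfl⟩ := hA
  by_contra! h
  exact hS g hg ⟨_, hv, fun i => by rw [h (v i) (mem_image_of_mem v (mem_univ i)), hcol]⟩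

theorem weight_restrict_le_omegaCrit (h2 : ∀ g ∈ 𝒢, 2 ≤ g.length) (hsparse : Sparse 𝒢)
    {D : Finset T.Vertex} (hD : ∀ A ⊆ D, ¬ T.IsBadEdge 𝒢 A)
    (hchain : IsChain (· ⊆ ·) (Sigma.fst '' (D : Set T.Vertex))) (β : Fin m → ℝ) :
    (T.restrict D).weight β ≤ omegaCrit 𝒢 β := by
  refine (isGreatest_omegaCrit hsparse h2 β).2 ⟨n, T.restrict D, fun S hS =>
    valid_of_containedIn_restrict hD hS.containedIn, hchain.mono fun x hx => ?_, rfl⟩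
  obtain ⟨c, hc⟩ := Template.mem_supp.1 (mem_coe.1 hx)
  exact ⟨_, mem_coe.2 (Template.mem_restrict.1 hc).2, rfl⟩

/-- The conclusion of the container theorem for the template `T`, with at most `b` containers and
a loss of a proportion `ε` of the size. -/
def Template.HasContainers (T : Template n m) (𝒢 : Finset (List (Fin m))) (b ε : ℝ) : Prop :=
  ∃ 𝒞 : Finset (Template n m), (∀ T' ∈ 𝒞, T' ≤ T) ∧
    (∀ I : ColoredSubset n m, I.Valid 𝒢 → I.ContainedIn T → ∃ T' ∈ 𝒞, I.ContainedIn T') ∧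
    (#𝒞 : ℝ) ≤ b ∧ ∀ T' ∈ 𝒞, (T'.size : ℝ) ≤ (1 - ε) * T.size

theorem Template.HasContainers.mono {b b' ε ε' : ℝ} (hb : b ≤ b') (hε : ε' ≤ ε)
    (h : T.HasContainers 𝒢 b ε) : T.HasContainers 𝒢 b' ε' := by
  obtain ⟨𝒞, hle, hcover, hcard, hsize⟩ := h
  exact ⟨𝒞, hle, hcover, hcard.trans hb, fun T' hT' => (hsize T' hT').trans (by gcongr)⟩

theorem Template.hasContainers_of_isBadEdge {w : Finset T.Vertex → ℝ} {b : ℕ} {ε : ℝ}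
    (hw : ∀ A, w A ≠ 0 → T.IsBadEdge 𝒢 A) (h : ColoredChains.HasContainers b ε w) :
    T.HasContainers 𝒢 b ε := by
  obtain ⟨𝒟, hcard, hsize, hcover⟩ := h
  refine ⟨𝒟.image T.restrict, ?_, fun I hI hIT => ?_, ?_, ?_⟩
  · exact forall_mem_image.2 fun D _ => Template.restrict_le D
  · obtain ⟨D, hD, hID⟩ := hcover {v | I v.1 = some v.2.1} fun A hA => by
      by_contra hne
      obtain ⟨v, hv, hvI⟩ := exists_mem_ne_of_valid hI (hw A hne)
      exact hvI (mem_filter.1 (hA hv)).2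
    refine ⟨_, mem_image_of_mem _ hD, fun x c hc => Template.mem_restrict.2 ⟨hIT x c hc, hID ?_⟩⟩
    exact mem_filter.2 ⟨mem_univ _, hc⟩
  · exact mod_cast card_image_le.trans hcard
  · refine forall_mem_image.2 fun D hD => ?_
    rw [Template.size_restrict, ← Template.card_vertex]
    exact hsize D hD

end Templates

section Supersaturation

variable {n m : ℕ} {𝒢 : Finset (List (Fin m))} {T : Template n m} {β : Fin m → ℝ}

theorem log_one_add_add_le {a b : ℝ} (ha : 0 ≤ a) (hb : 0 ≤ b) :
    Real.log (1 + (a + b)) ≤ Real.log (1 + a) + b := by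
  rw [← sub_le_iff_le_add', ← Real.log_div (by positivity) (by positivity)]
  refine (Real.log_le_sub_one_of_pos (by positivity)).trans ?_
  rw [sub_le_iff_le_add, div_le_iff₀ (by positivity)]
  nlinarith

theorem log_one_add_sum_nonneg (hβ : 0 ≤ β) (s : Finset (Fin m)) :
    0 ≤ Real.log (1 + ∑ i ∈ s, β i) :=
  Real.log_nonneg (le_add_of_nonneg_right (sum_nonneg fun i _ => hβ i))

theorem log_one_add_sum_le_restrict (hβ : 0 ≤ β) (D : Finset T.Vertex) (x : Finset (Fin n)) :
    Real.log (1 + ∑ i ∈ T x, β i) ≤ Real.log (1 + ∑ i ∈ T.restrict D x, β i) +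
      ∑ c : T x, if ⟨x, c⟩ ∈ D then 0 else β c := by
  have hsplit : ∑ i ∈ T x, β i = ∑ i ∈ T.restrict D x, β i +
      ∑ c : T x, if ⟨x, c⟩ ∈ D then 0 else β c := by
    rw [Template.sum_restrict, ← sum_add_distrib, ← sum_coe_sort]
    exact sum_congr rfl fun c _ => by split_ifs <;> simp
  rw [hsplit]
  exact log_one_add_add_le (sum_nonneg fun i _ => hβ i) (sum_nonneg fun c _ => by
    split_ifs
    exacts [le_rfl, hβ c])

theorem sum_mul_log_le (hβ : 0 ≤ β) (D : Finset T.Vertex) (P : Finset (Finset (Fin n)))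
    {z : Finset (Fin n) → ℝ} (hz : z ∈ Set.Icc 0 1) :
    ∑ x ∈ P, z x * Real.log (1 + ∑ i ∈ T x, β i) ≤
      (T.restrict D).weight β + ∑ v : T.Vertex with v.1 ∈ P ∧ v ∉ D, z v.1 * β v.2 := by
  have hP : ∑ v : T.Vertex with v.1 ∈ P ∧ v ∉ D, z v.1 * β v.2 =
      ∑ x ∈ P, z x * ∑ c : T x, if ⟨x, c⟩ ∈ D then 0 else β c := by
    rw [sum_filter, Fintype.sum_sigma, ← sum_subset (subset_univ P) fun x _ hx => by simp [hx]]
    refine sum_congr rfl fun x hx => ?_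
    rw [mul_sum]
    exact sum_congr rfl fun c _ => by by_cases hc : ⟨x, c⟩ ∈ D <;> simp [hx, hc]
  have hweight : ∑ x ∈ P, Real.log (1 + ∑ i ∈ T.restrict D x, β i) ≤ (T.restrict D).weight β :=
    sum_le_sum_of_subset_of_nonneg (subset_univ P) fun x _ _ => log_one_add_sum_nonneg hβ _
  rw [hP]
  refine le_trans ?_ (add_le_add_left hweight _)
  rw [← sum_add_distrib]
  refine sum_le_sum fun x _ => ?_
  refine (mul_le_mul_of_nonneg_left (log_one_add_sum_le_restrict hβ D x) (hz.1 x)).trans ?_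
  rw [mul_add]
  gcongr
  exact mul_le_of_le_one_left (log_one_add_sum_nonneg hβ _) (hz.2 x)

theorem sum_mul_log_le_of_saturated (hβ : 0 ≤ β) {D : Finset T.Vertex}
    {P : Finset (Finset (Fin n))} {z : Finset (Fin n) → ℝ} (hz : z ∈ Set.Icc 0 1)
    {d : T.Vertex → ℝ} (hd : 0 ≤ d) (hsat : ∀ v : T.Vertex, v.1 ∈ P → v ∉ D → d v = z v.1) :
    ∑ x ∈ P, z x * Real.log (1 + ∑ i ∈ T x, β i) ≤
      (T.restrict D).weight β + (∑ i, β i) * ∑ v, d v := by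
  refine (sum_mul_log_le hβ D P hz).trans (add_le_add_right ?_ _)
  have hB : 0 ≤ ∑ i, β i := sum_nonneg fun i _ => hβ i
  calc ∑ v : T.Vertex with v.1 ∈ P ∧ v ∉ D, z v.1 * β v.2
      ≤ ∑ v : T.Vertex with v.1 ∈ P ∧ v ∉ D, (∑ i, β i) * d v := sum_le_sum fun v hv => by
        obtain ⟨hvP, hvD⟩ := (mem_filter.1 hv).2
        rw [hsat v hvP hvD, mul_comm]
        exact mul_le_mul_of_nonneg_right (single_le_sum (fun i _ => hβ i) (mem_univ _)) (hz.1 _)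
    _ ≤ ∑ v, (∑ i, β i) * d v :=
        sum_le_sum_of_subset_of_nonneg (filter_subset _ _) fun v _ _ => mul_nonneg hB (hd v)
    _ = (∑ i, β i) * ∑ v, d v := (mul_sum _ _ _).symm

/-- The vertices on a maximal chain that are not saturated by the packing form a valid template, so
their weight is at most critical. The others are paid for by the edges through them. -/
theorem exists_packing_on_chain (h2 : ∀ g ∈ 𝒢, 2 ≤ g.length) (hsparse : Sparse 𝒢) (hβ : 0 ≤ β)
    (T : Template n m) {z : Finset (Fin n) → ℝ} (hz : z ∈ Set.Icc 0 1) (f : Numbering (Fin n)) :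
    ∃ y : Finset T.Vertex → ℝ, 0 ≤ y ∧
      (∀ A, y A ≠ 0 → T.IsBadEdge 𝒢 A ∧ ∀ v ∈ A, f.IsPrefix v.1) ∧
      (∀ v, degree {v} y ≤ z v.1) ∧
      ∑ x with f.IsPrefix x, z x * Real.log (1 + ∑ i ∈ T x, β i) ≤
        omegaCrit 𝒢 β + (∑ i, β i) * (𝒢.sup List.length * degree ∅ y) := by
  classical
  obtain ⟨y, hy, hout, hle, hsat⟩ := exists_saturating_packing
    {A : Finset T.Vertex | T.IsBadEdge 𝒢 A ∧ ∀ v ∈ A, f.IsPrefix v.1} (fun A hA => by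
      obtain ⟨g, hg, hcard⟩ := (mem_filter.1 hA).2.1.exists_card_eq
      exact card_pos.1 (by have := h2 g hg; omega)) (z := fun v => z v.1) fun v => hz.1 v.1
  have hsupp : ∀ A, y A ≠ 0 → T.IsBadEdge 𝒢 A ∧ ∀ v ∈ A, f.IsPrefix v.1 := fun A hA =>
    (mem_filter.1 (not_imp_comm.1 (hout A) hA)).2
  refine ⟨y, hy, hsupp, hle, ?_⟩
  set D : Finset T.Vertex := {v | f.IsPrefix v.1 ∧ degree {v} y ≠ z v.1}
  have hDvalid : ∀ A ⊆ D, ¬ T.IsBadEdge 𝒢 A := fun A hAD hA => by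
    obtain ⟨v, hv, hvz⟩ := hsat A
      (mem_filter.2 ⟨mem_univ A, hA, fun v hv => (mem_filter.1 (hAD hv)).2.1⟩)
    exact (mem_filter.1 (hAD hv)).2.2 hvz
  have hDchain : IsChain (· ⊆ ·) (Sigma.fst '' (D : Set T.Vertex)) := by
    rintro _ ⟨u, hu, rfl⟩ _ ⟨v, hv, rfl⟩ -
    have hu' := (mem_filter.1 (mem_coe.1 hu)).2.1
    have hv' := (mem_filter.1 (mem_coe.1 hv)).2.1
    exact (le_total #u.1 #v.1).imp (hu'.subset_of_card_le_card hv')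
      (hv'.subset_of_card_le_card hu')
  refine (sum_mul_log_le_of_saturated hβ hz (d := fun v => degree {v} y) (D := D)
    (fun v => degree_nonneg _ hy) fun v hvf hvD => ?_).trans ?_
  · by_contra hne
    exact hvD (mem_filter.2 ⟨mem_univ v, (mem_filter.1 hvf).2, hne⟩)
  have hB : 0 ≤ ∑ i, β i := sum_nonneg fun i _ => hβ i
  gcongr
  · exact weight_restrict_le_omegaCrit h2 hsparse hDvalid hDchain β
  · exact sum_degree_singleton_le hy fun A hA => (hsupp A hA).1.card_le

end Supersaturation

section Averaging

open Numbering

variable {n m : ℕ} {𝒢 : Finset (List (Fin m))} {T : Template n m} {β : Fin m → ℝ}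

/-- The size of the layer of `x` relative to the middle layer. Weighted like this, all layers are
equally likely to contain a random member of a random maximal chain. -/
noncomputable def layerRatio (x : Finset (Fin n)) : ℝ :=
  n.choose #x / n.choose (n / 2)

theorem choose_half_pos (n : ℕ) : (0 : ℝ) < n.choose (n / 2) :=
  mod_cast Nat.choose_pos (Nat.div_le_self n 2)

theorem layerRatio_mem_Icc : (layerRatio : Finset (Fin n) → ℝ) ∈ Set.Icc 0 1 :=
  ⟨fun x => by simp only [layerRatio]; positivity,
    fun x => (div_le_one (choose_half_pos n)).2 (mod_cast Nat.choose_le_middle _ _)⟩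

theorem card_prefixed_mul_layerRatio (x : Finset (Fin n)) :
    #(prefixed x) * layerRatio x = n.factorial / n.choose (n / 2) := by
  have h := card_prefixed_mul_choose x
  rw [Fintype.card_fin] at h
  rw [layerRatio, ← mul_div_assoc, ← h, Nat.cast_mul]

theorem sum_sum_layerRatio_mul (F : Finset (Fin n) → ℝ) :
    ∑ f : Numbering (Fin n), ∑ x with f.IsPrefix x, layerRatio x * F x =
      n.factorial / n.choose (n / 2) * ∑ x, F x := by
  simp only [sum_filter]
  rw [sum_comm, mul_sum]
  refine sum_congr rfl fun x _ => ?_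
  rw [← card_prefixed_mul_layerRatio x, mul_assoc, ← sum_filter, sum_const, nsmul_eq_mul, prefixed]

theorem degree_le_of_forall_isPrefix {y : Finset T.Vertex → ℝ} {f : Numbering (Fin n)}
    (hy : 0 ≤ y) (hsupp : ∀ A, y A ≠ 0 → ∀ v ∈ A, f.IsPrefix v.1) {X : Finset T.Vertex}
    {v : T.Vertex} (hv : v ∈ X) :
    degree X y ≤ if f ∈ commonPrefixed (X.image Sigma.fst) then degree {v} y else 0 := by
  split_ifs with hf
  · exact degree_antitone hy (singleton_subset_iff.2 hv)
  · refine (degree_eq_zero fun A hXA => ?_).le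
    by_contra hA
    exact hf (mem_commonPrefixed.2 (forall_mem_image.2 fun u hu => hsupp A hA u (hXA hu)))

theorem sum_degree_mul_pow_le {y : Numbering (Fin n) → Finset T.Vertex → ℝ} {r : ℝ}
    (hr : 0 ≤ r) (hT : ∀ x ∈ T.supp, r ≤ #xᶜ) (hy : ∀ f, 0 ≤ y f)
    (hsupp : ∀ f A, y f A ≠ 0 → T.IsBadEdge 𝒢 A ∧ ∀ v ∈ A, f.IsPrefix v.1)
    (hle : ∀ f v, degree {v} (y f) ≤ layerRatio v.1) {X : Finset T.Vertex} (hX : X.Nonempty) :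
    (∑ f, degree X (y f)) * r ^ (#X - 1) ≤ n.factorial / n.choose (n / 2) := by
  by_cases hedge : ∃ A, T.IsBadEdge 𝒢 A ∧ X ⊆ A
  swap
  · have hzero : ∑ f, degree X (y f) = 0 := sum_eq_zero fun f _ => degree_eq_zero fun A hXA => by
      by_contra hA
      exact hedge ⟨A, (hsupp f A hA).1, hXA⟩
    rw [hzero, zero_mul]
    positivity
  obtain ⟨A, hA, hXA⟩ := hedge
  obtain ⟨x, hx, hxX⟩ := exists_card_commonPrefixed_mul_pow_le (hX.image Sigma.fst)
    (hA.isChain_image_fst.mono (by simpa using Set.image_mono (coe_subset.2 hXA))) hr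
    (forall_mem_image.2 fun v _ => hT v.1 v.fst_mem_supp)
  rw [card_image_of_injOn (hA.injOn_fst.mono (coe_subset.2 hXA))] at hxX
  obtain ⟨v, hv, rfl⟩ := mem_image.1 hx
  have hsum : ∑ f, degree X (y f) ≤ #(commonPrefixed (X.image Sigma.fst)) * layerRatio v.1 := by
    rw [← nsmul_eq_mul, ← sum_const, ← univ_inter (commonPrefixed _), ← sum_ite_mem]
    exact sum_le_sum fun f _ => (degree_le_of_forall_isPrefix (hy f)
      (fun A hA => (hsupp f A hA).2) hv).trans (by split_ifs <;> simp [hle f v])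
  calc (∑ f, degree X (y f)) * r ^ (#X - 1)
      ≤ #(commonPrefixed (X.image Sigma.fst)) * layerRatio v.1 * r ^ (#X - 1) := by gcongr
    _ = #(commonPrefixed (X.image Sigma.fst)) * r ^ (#X - 1) * layerRatio v.1 := by ring
    _ ≤ #(prefixed v.1) * layerRatio v.1 :=
        mul_le_mul_of_nonneg_right hxX (layerRatio_mem_Icc.1 v.1)
    _ = n.factorial / n.choose (n / 2) := card_prefixed_mul_layerRatio v.1

/-- Supersaturation: average the packings on the maximal chains. -/
theorem exists_weight_on_badEdges (h2 : ∀ g ∈ 𝒢, 2 ≤ g.length) (hsparse : Sparse 𝒢) (hβ : 0 ≤ β)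
    {r : ℝ} (hr : 0 ≤ r) (hT : ∀ x ∈ T.supp, r ≤ #xᶜ) :
    ∃ w : Finset T.Vertex → ℝ, 0 ≤ w ∧ (∀ A, w A ≠ 0 → T.IsBadEdge 𝒢 A) ∧
      T.weight β ≤ omegaCrit 𝒢 β * n.choose (n / 2) +
        (∑ i, β i) * (𝒢.sup List.length * degree ∅ w) ∧
      ∀ X : Finset T.Vertex, X.Nonempty → degree X w * r ^ (#X - 1) ≤ 1 := by
  choose y hy hsupp hle hweight using
    exists_packing_on_chain h2 hsparse hβ T (layerRatio_mem_Icc (n := n))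
  have hN := choose_half_pos n
  have hF : (0 : ℝ) < n.factorial := mod_cast n.factorial_pos
  set N : ℝ := ((n.choose (n / 2) : ℕ) : ℝ)
  refine ⟨(N / n.factorial) • ∑ f, y f, ?_, fun A hA => ?_, ?_, fun X hX => ?_⟩
  · exact smul_nonneg (by positivity) (sum_nonneg fun f _ => hy f)
  · rw [Pi.smul_apply, Finset.sum_apply] at hA
    obtain ⟨f, -, hf⟩ := exists_ne_zero_of_sum_ne_zero (right_ne_zero_of_smul hA)
    exact (hsupp f A hf).1
  · have hcard : Fintype.card (Numbering (Fin n)) = n.factorial := by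
      rw [Fintype.card_numbering, Fintype.card_fin]
    have hsum := sum_le_sum fun f (_ : f ∈ univ) => hweight f
    rw [sum_sum_layerRatio_mul, sum_add_distrib, ← mul_sum, ← mul_sum, sum_const, nsmul_eq_mul,
      card_univ, hcard, ← map_sum] at hsum
    rw [map_smul, smul_eq_mul]
    calc T.weight β = N / n.factorial * (n.factorial / N * T.weight β) := by field_simp
      _ ≤ N / n.factorial * (n.factorial * omegaCrit 𝒢 β +
          (∑ i, β i) * (𝒢.sup List.length * degree ∅ (∑ f, y f))) := by gcongr; exact hsum
      _ = _ := by field_simp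
  · rw [map_smul, map_sum, smul_eq_mul, mul_assoc]
    calc N / n.factorial * ((∑ f, degree X (y f)) * r ^ (#X - 1))
        ≤ N / n.factorial * (n.factorial / N) := by
          gcongr
          exact sum_degree_mul_pow_le hr hT hy hsupp hle hX
      _ = 1 := by field_simp

end Averaging

section Estimates

open Filter Topology

variable {n m : ℕ} {𝒢 : Finset (List (Fin m))} {T : Template n m} {β : Fin m → ℝ}

theorem Template.size_le (T : Template n m) : T.size ≤ m * 2 ^ n :=
  (sum_le_card_nsmul univ _ m fun x _ => card_finset_fin_le (T x)).trans_eq <| by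
    rw [card_univ, Fintype.card_finset, Fintype.card_fin, smul_eq_mul, mul_comm]

theorem Template.weight_le (hβ : 0 ≤ β) (T : Template n m) :
    T.weight β ≤ (∑ i, β i) * T.size := by
  rw [Template.weight, Template.size, Nat.cast_sum, mul_sum]
  refine sum_le_sum fun x _ => ?_
  calc Real.log (1 + ∑ i ∈ T x, β i)
      ≤ ∑ i ∈ T x, β i := by
        have h := Real.log_le_sub_one_of_pos (x := 1 + ∑ i ∈ T x, β i)
          (add_pos_of_pos_of_nonneg one_pos (sum_nonneg fun i _ => hβ i))
        linarith
    _ ≤ #(T x) • ∑ i, β i :=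
        sum_le_card_nsmul _ _ _ fun i _ => single_le_sum (fun i _ => hβ i) (mem_univ i)
    _ = (∑ i, β i) * #(T x) := by rw [nsmul_eq_mul, mul_comm]

theorem exists_mul_card_le_log (hβ : ∀ i, 0 < β i) :
    ∃ b : ℝ, 0 < b ∧ ∀ s : Finset (Fin m), b * #s ≤ Real.log (1 + ∑ i ∈ s, β i) := by
  have hsmall : ∀ s : Finset (Fin m),
      ∀ᶠ b : ℝ in 𝓝[>] 0, b * #s ≤ Real.log (1 + ∑ i ∈ s, β i) := fun s => by
    rcases s.eq_empty_or_nonempty with rfl | hs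
    · simp
    · have hlog : 0 < Real.log (1 + ∑ i ∈ s, β i) :=
        Real.log_pos (lt_add_of_pos_right 1 (sum_pos (fun i _ => hβ i) hs))
      have hcard : (0 : ℝ) < #s := mod_cast hs.card_pos
      filter_upwards [Ioc_mem_nhdsGT (div_pos hlog hcard)] with b hb
      exact (le_div_iff₀ hcard).1 hb.2
  exact ((eventually_mem_nhdsWithin (s := Set.Ioi (0 : ℝ))).and (eventually_all.2 hsmall)).exists

theorem exists_mul_size_le_weight (hβ : ∀ i, 0 < β i) :
    ∃ b : ℝ, 0 < b ∧ ∀ (n : ℕ) (T : Template n m), b * T.size ≤ T.weight β := by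
  obtain ⟨b, hb, hle⟩ := exists_mul_card_le_log hβ
  refine ⟨b, hb, fun n T => ?_⟩
  rw [Template.weight, Template.size, Nat.cast_sum, mul_sum]
  exact sum_le_sum fun x _ => hle (T x)

theorem omegaCrit_nonneg (h2 : ∀ g ∈ 𝒢, 2 ≤ g.length) (hsparse : Sparse 𝒢) (hβ : 0 ≤ β) :
    0 ≤ omegaCrit 𝒢 β := by
  obtain ⟨n, T, -, -, hT⟩ := (isGreatest_omegaCrit hsparse h2 β).1
  exact hT ▸ sum_nonneg fun x _ => log_one_add_sum_nonneg hβ (T x)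

theorem log_one_add_le_omegaCrit (h2 : ∀ g ∈ 𝒢, 2 ≤ g.length) (hsparse : Sparse 𝒢) (c : Fin m) :
    Real.log (1 + β c) ≤ omegaCrit 𝒢 β := by
  refine (isGreatest_omegaCrit hsparse h2 β).2 ⟨0, fun _ => {c}, ?_, ?_, by simp [Template.weight]⟩
  · rintro S - g hg ⟨x, hx, -⟩
    have : Nontrivial (Fin g.length) := Fin.nontrivial_iff_two_le.2 (h2 g hg)
    obtain ⟨i, j, hij⟩ := exists_pair_ne (Fin g.length)
    exact hij (hx.injective (Subsingleton.elim _ _))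
  · exact fun a _ b _ h => absurd (Subsingleton.elim a b) h

theorem exists_mul_choose_le_size (h2 : ∀ g ∈ 𝒢, 2 ≤ g.length) (hsparse : Sparse 𝒢)
    (hβ : ∀ i, 0 < β i) :
    ∃ a : ℝ, 0 < a ∧ ∀ (n : ℕ) (T : Template n m),
      omegaCrit 𝒢 β * n.choose (n / 2) < T.weight β → a * n.choose (n / 2) ≤ T.size := by
  have hβ0 : 0 ≤ β := fun i => (hβ i).le
  rcases isEmpty_or_nonempty (Fin m) with hm | ⟨⟨c⟩⟩
  · refine ⟨1, one_pos, fun n T hT => absurd hT (not_lt.2 ((T.weight_le hβ0).trans ?_))⟩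
    rw [univ_eq_empty, sum_empty, zero_mul]
    exact mul_nonneg (omegaCrit_nonneg h2 hsparse hβ0) (choose_half_pos n).le
  · have hB : 0 < ∑ i, β i := sum_pos (fun i _ => hβ i) ⟨c, mem_univ c⟩
    have hω : 0 < omegaCrit 𝒢 β := (Real.log_pos (lt_add_of_pos_right 1 (hβ c))).trans_le
      (log_one_add_le_omegaCrit h2 hsparse c)
    refine ⟨omegaCrit 𝒢 β / ∑ i, β i, div_pos hω hB, fun n T hT => ?_⟩
    rw [div_mul_eq_mul_div, div_le_iff₀' hB]
    exact hT.le.trans (T.weight_le hβ0)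

theorem mul_sub_one_div_two_le_choose_half (n : ℕ) :
    (n : ℝ) * (n - 1) / 2 ≤ n.choose (n / 2) := by
  rw [← Nat.cast_choose_two]
  exact mod_cast Nat.choose_le_middle 2 n

theorem mul_log_two_le (hn : 2 ≤ n) {a s : ℝ} (ha : 0 ≤ a) (h : a * n.choose (n / 2) ≤ s) :
    a * Real.log 2 ≤ Real.log n / n * s := by
  have hn0 : (0 : ℝ) < n := mod_cast (by lia : 0 < n)
  have hnN : (n : ℝ) ≤ n.choose (n / 2) :=
    mod_cast (Nat.choose_one_right n).symm.trans_le (Nat.choose_le_middle 1 n)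
  calc a * Real.log 2 ≤ a * Real.log n := by gcongr; exact mod_cast hn
    _ = Real.log n / n * (a * n) := by field_simp
    _ ≤ Real.log n / n * s := by
        gcongr
        exact (by gcongr : a * n ≤ a * n.choose (n / 2)).trans h

theorem Template.IsBadEdge.two_le {A : Finset T.Vertex} (hA : T.IsBadEdge 𝒢 A)
    (h2 : ∀ g ∈ 𝒢, 2 ≤ g.length) {θ : ℝ} (hθ : θ < 1) (hT : ∀ x ∈ T.supp, (#x : ℝ) ≤ θ * n) :
    2 ≤ n := by
  obtain ⟨g, hg, v, hv, -, -⟩ := hA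
  have hlt : #(v ⟨0, two_pos.trans_le (h2 g hg)⟩).1 < #(v ⟨1, h2 g hg⟩).1 :=
    card_lt_card (hv (by simp))
  have hn : (0 : ℝ) < n := mod_cast hlt.pos.trans_le (card_finset_fin_le _)
  have hcard : (#(v ⟨1, h2 g hg⟩).1 : ℝ) < n :=
    (hT _ (v ⟨1, h2 g hg⟩).fst_mem_supp).trans_lt (mul_lt_of_lt_one_left hn hθ)
  have := Nat.cast_lt.1 hcard
  lia

end Estimates

section Containers

open Filter

variable {n m : ℕ} {𝒢 : Finset (List (Fin m))} {T : Template n m} {β : Fin m → ℝ}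

theorem hasContainers_of_apply_ne_zero {α : Type*} [Fintype α]
    {w : Finset α → ℝ} {A : Finset α} (hA : w A ≠ 0) :
    HasContainers #A (1 / Fintype.card α) w := by
  classical
  refine ⟨A.image univ.erase, card_image_le, forall_mem_image.2 fun a _ => ?_, fun I hI => ?_⟩
  · have hcard : (0 : ℝ) < Fintype.card α := mod_cast Fintype.card_pos_iff.2 ⟨a⟩
    rw [card_erase_of_mem (mem_univ a), card_univ, Nat.cast_pred (mod_cast hcard)]
    exact le_of_eq (by field_simp)
  · obtain ⟨a, ha, haI⟩ := not_subset.1 fun h => hA (hI A h)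
    exact ⟨_, mem_image_of_mem _ ha, fun b hb => mem_erase.2 ⟨fun h => haI (h ▸ hb), mem_univ b⟩⟩

theorem isSpread_inv {α : Type*} [Fintype α] [DecidableEq α] {w : Finset α → ℝ} {c r K : ℝ}
    (hr : 0 < r) (hK0 : 0 ≤ K) (hc : c * Fintype.card α ≤ degree ∅ w) (hK : 1 ≤ K * c)
    (hdeg : ∀ X : Finset α, X.Nonempty → degree X w * r ^ (#X - 1) ≤ 1) :
    IsSpread K r⁻¹ w := by
  intro X hX
  have hdegree : degree X w ≤ r⁻¹ ^ (#X - 1) := by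
    rw [inv_pow, ← one_div, le_div_iff₀ (by positivity)]
    exact hdeg X hX
  calc degree X w * Fintype.card α ≤ r⁻¹ ^ (#X - 1) * (K * c * Fintype.card α) := by
        gcongr
        exact le_mul_of_one_le_left (Nat.cast_nonneg _) hK
    _ = K * r⁻¹ ^ (#X - 1) * (c * Fintype.card α) := by ring
    _ ≤ K * r⁻¹ ^ (#X - 1) * degree ∅ w := by gcongr

theorem card_filter_card_le_pow_le_exp (α : Type*) [Fintype α] {n : ℕ} (hn : 3 ≤ n) (D : ℝ)
    (k : ℕ) :
    (#{S : Finset α | #S ≤ D / n * Fintype.card α} ^ k : ℝ) ≤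
      Real.exp ((D + 1) * k * (Real.log n / n) * Fintype.card α) := by
  have hn0 : (3 : ℝ) ≤ n := mod_cast hn
  have hlog : 1 ≤ Real.log n :=
    (Real.le_log_iff_exp_le (by linarith)).2 (Real.exp_one_lt_three.le.trans hn0)
  calc (#{S : Finset α | #S ≤ D / n * Fintype.card α} ^ k : ℝ)
      ≤ Real.exp (D / n * Fintype.card α * Real.log n + Fintype.card α / n) ^ k := by
        gcongr
        exact card_filter_card_le_exp α (by linarith)
    _ = Real.exp (k * (D * (Real.log n / n) * Fintype.card α + 1 / n * Fintype.card α)) := by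
        rw [← Real.exp_nat_mul]
        ring_nf
    _ ≤ Real.exp (k * (D * (Real.log n / n) * Fintype.card α +
          Real.log n / n * Fintype.card α)) := by gcongr
    _ = Real.exp ((D + 1) * k * (Real.log n / n) * Fintype.card α) := by ring_nf

theorem exists_spread_weight (h2 : ∀ g ∈ 𝒢, 2 ≤ g.length) (hsparse : Sparse 𝒢)
    (hβ : ∀ i, 0 < β i) {α : ℝ} (hα : 0 < α) :
    ∃ c : ℝ, 0 < c ∧ ∀ (n : ℕ) (T : Template n m) (r : ℝ), 0 ≤ r →
      (∀ x ∈ T.supp, r ≤ #xᶜ) → (omegaCrit 𝒢 β + α) * n.choose (n / 2) ≤ T.weight β →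
      ∃ w : Finset T.Vertex → ℝ, 0 ≤ w ∧ (∀ A, w A ≠ 0 → T.IsBadEdge 𝒢 A) ∧
        0 < degree ∅ w ∧ c * T.size ≤ degree ∅ w ∧
        ∀ X : Finset T.Vertex, X.Nonempty → degree X w * r ^ (#X - 1) ≤ 1 := by
  have hβ0 : 0 ≤ β := fun i => (hβ i).le
  have hω := omegaCrit_nonneg h2 hsparse hβ0
  have hB : 0 ≤ ∑ i, β i := sum_nonneg fun i _ => hβ0 i
  obtain ⟨b, hb, hsize⟩ := exists_mul_size_le_weight hβ
  set C : ℝ := (∑ i, β i) * 𝒢.sup List.length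
  have hC : 0 ≤ C := by positivity
  refine ⟨α * b / ((omegaCrit 𝒢 β + α) * (C + 1)), by positivity, fun n T r hr hT hweight => ?_⟩
  obtain ⟨w, hw, hedge, hle, hdeg⟩ := exists_weight_on_badEdges h2 hsparse hβ0 hr hT
  rw [← mul_assoc] at hle
  have hN := choose_half_pos n
  have hexcess : 0 < C * degree ∅ w := by nlinarith
  have hW : 0 < degree ∅ w := pos_of_mul_pos_right hexcess hC
  refine ⟨w, hw, hedge, hW, ?_, hdeg⟩
  rw [div_mul_eq_mul_div, div_le_iff₀ (by positivity)]
  calc α * b * T.size = α * (b * T.size) := by ring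
    _ ≤ α * T.weight β := by gcongr; exact hsize n T
    _ ≤ (omegaCrit 𝒢 β + α) * (C * degree ∅ w) := by nlinarith
    _ ≤ (omegaCrit 𝒢 β + α) * ((C + 1) * degree ∅ w) := by gcongr; linarith
    _ = degree ∅ w * ((omegaCrit 𝒢 β + α) * (C + 1)) := by ring

theorem le_card_compl {θ : ℝ} {x : Finset (Fin n)} (hx : (#x : ℝ) ≤ θ * n) :
    (1 - θ) * n ≤ #xᶜ := by
  rw [card_compl, Fintype.card_fin, Nat.cast_sub (card_finset_fin_le x)]
  linarith

theorem eventually_le_div_mul {a D : ℝ} (ha : 0 < a) (hD : 0 < D) (M : ℝ) :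
    ∀ᶠ n : ℕ in atTop, ∀ s : ℝ, a * n.choose (n / 2) ≤ s → M ≤ D / n * s := by
  filter_upwards [tendsto_natCast_atTop_atTop.eventually_ge_atTop (2 * M / (D * a) + 1),
    eventually_gt_atTop 0] with n hnM hn0 s hs
  have hn : (0 : ℝ) < n := mod_cast hn0
  have hM : 2 * M ≤ D * a * (n - 1) := by
    rw [← div_le_iff₀' (by positivity)]
    linarith
  calc M ≤ D * a * (n - 1) / 2 := by linarith
    _ = D / n * (a * (n * (n - 1) / 2)) := by field_simp
    _ ≤ D / n * (a * n.choose (n / 2)) := by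
        gcongr
        exact mul_sub_one_div_two_le_choose_half n
    _ ≤ D / n * s := by gcongr

theorem eventually_hasContainers (h2 : ∀ g ∈ 𝒢, 2 ≤ g.length) (hsparse : Sparse 𝒢)
    (hβ : ∀ i, 0 < β i) {θ : ℝ} (hθ : θ < 1) {α : ℝ} (hα : 0 < α) :
    ∃ ε : ℝ, 0 < ε ∧ ∀ᶠ n : ℕ in atTop, ∀ T : Template n m,
      (∀ x ∈ T.supp, (#x : ℝ) ≤ θ * n) →
      (omegaCrit 𝒢 β + α) * n.choose (n / 2) ≤ T.weight β →
      T.HasContainers 𝒢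
        (Real.exp (((1 - θ)⁻¹ + 1) * 𝒢.sup List.length * (Real.log n / n) * T.size)) ε := by
  obtain ⟨a, ha, hsize⟩ := exists_mul_choose_le_size h2 hsparse hβ
  obtain ⟨c, hc, hspread⟩ := exists_spread_weight h2 hsparse hβ hα
  obtain ⟨δ, hδ, M, hcontainers⟩ :=
    exists_hasContainers (𝒢.sup List.length) (max 1 c⁻¹) (le_max_left _ _)
  have hD : 0 < (1 - θ)⁻¹ := inv_pos.2 (sub_pos.2 hθ)
  refine ⟨δ, hδ, ?_⟩
  filter_upwards [eventually_ge_atTop 3, eventually_le_div_mul ha hD M,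
    tendsto_natCast_atTop_atTop.eventually_ge_atTop (1 - θ)⁻¹] with n hn hM hDn T hT hweight
  have hn0 : (0 : ℝ) < n := mod_cast (by lia : 0 < n)
  have hr : 0 < (1 - θ) * n := mul_pos (sub_pos.2 hθ) hn0
  obtain ⟨w, hw, hedge, hW, hWT, hdeg⟩ :=
    hspread n T _ hr.le (fun x hx => le_card_compl (hT x hx)) hweight
  have hlt : omegaCrit 𝒢 β * n.choose (n / 2) < T.weight β :=
    (mul_lt_mul_of_pos_right (lt_add_of_pos_right _ hα) (choose_half_pos n)).trans_le hweight
  have hMT := hM _ (hsize n T hlt)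
  have hp : ((1 - θ) * n)⁻¹ = (1 - θ)⁻¹ / n := by rw [mul_inv, div_eq_mul_inv]
  rw [← T.card_vertex] at hWT hMT ⊢
  have hspreadw : IsSpread (max 1 c⁻¹) ((1 - θ)⁻¹ / n) w := hp ▸ isSpread_inv hr (by positivity) hWT
    ((inv_mul_cancel₀ hc.ne').symm.trans_le (by gcongr; exact le_max_right _ _)) hdeg
  refine (Template.hasContainers_of_isBadEdge hedge (hcontainers _ _ w (by positivity)
    ((div_le_one hn0).2 hDn) hMT hw hW (fun A hA => (hedge A hA).card_le) hspreadw)).mono ?_ le_rfl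
  exact mod_cast card_filter_card_le_pow_le_exp T.Vertex hn (1 - θ)⁻¹ (𝒢.sup List.length)

theorem exists_hasContainers_of_lt (h2 : ∀ g ∈ 𝒢, 2 ≤ g.length) (hsparse : Sparse 𝒢)
    (hβ : ∀ i, 0 < β i) {θ : ℝ} (hθ : θ < 1) :
    ∃ K : ℝ, 0 ≤ K ∧ ∀ n₀ : ℕ, ∃ ε : ℝ, 0 < ε ∧ ∀ n < n₀, ∀ T : Template n m,
      (∀ x ∈ T.supp, (#x : ℝ) ≤ θ * n) → omegaCrit 𝒢 β * n.choose (n / 2) < T.weight β →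
      T.HasContainers 𝒢 (Real.exp (K * (Real.log n / n) * T.size)) ε := by
  obtain ⟨a, ha, hsize⟩ := exists_mul_choose_le_size h2 hsparse hβ
  set ℓ : ℝ := Real.log (𝒢.sup List.length : ℕ)
  have hℓ : 0 ≤ ℓ := Real.log_natCast_nonneg _
  have hlog2 : 0 < Real.log 2 := Real.log_pos one_lt_two
  refine ⟨ℓ / (a * Real.log 2), by positivity, fun n₀ => ⟨1 / (m * 2 ^ n₀ + 1), by positivity,
    fun n hn T hT hlt => ?_⟩⟩
  obtain ⟨w, -, hedge, hle, -⟩ := exists_weight_on_badEdges h2 hsparse (fun i => (hβ i).le) le_rfl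
    fun x (_ : x ∈ T.supp) => Nat.cast_nonneg #xᶜ
  obtain ⟨A, -, hA⟩ := exists_ne_zero_of_sum_ne_zero (s := univ) (f := w) fun hsum => by
    rw [degree_empty, hsum, mul_zero, mul_zero, add_zero] at hle
    exact hle.not_gt hlt
  refine (Template.hasContainers_of_isBadEdge hedge (hasContainers_of_apply_ne_zero hA)).mono ?_ ?_
  · calc (#A : ℝ) ≤ (𝒢.sup List.length : ℕ) := mod_cast (hedge A hA).card_le
      _ ≤ Real.exp ℓ := Real.le_exp_log _
      _ = Real.exp (ℓ / (a * Real.log 2) * (a * Real.log 2)) := by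
          rw [div_mul_cancel₀ _ (by positivity)]
      _ ≤ Real.exp (ℓ / (a * Real.log 2) * (Real.log n / n * T.size)) := by
          gcongr Real.exp (_ * ?_)
          exact mul_log_two_le ((hedge A hA).two_le h2 hθ hT) ha.le (hsize n T hlt)
      _ = Real.exp (ℓ / (a * Real.log 2) * (Real.log n / n) * T.size) := by rw [mul_assoc]
  · have hcard : 0 < T.size := by
      have h := (mul_pos ha (choose_half_pos n)).trans_le (hsize n T hlt)
      exact mod_cast h
    rw [T.card_vertex]
    gcongr
    calc (T.size : ℝ) ≤ m * 2 ^ n := mod_cast T.size_le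
      _ ≤ m * 2 ^ n₀ := by gcongr; exact one_le_two
      _ ≤ m * 2 ^ n₀ + 1 := le_add_of_nonneg_right one_pos.le

end Containers

end ColoredChains

theorem mainTheorem5_general (m : ℕ) (𝒢 : Finset (List (Fin m)))
    (h2 : ∀ g ∈ 𝒢, 2 ≤ g.length) (hsparse : ColoredChains.Sparse 𝒢)
    (β : Fin m → ℝ) (hβ : ∀ i, 0 < β i) (θ : ℝ) (hθ : θ < 1) :
    ∃ K : ℝ, 0 < K ∧ ∀ α : ℝ, 0 < α → ∃ ε : ℝ, 0 < ε ∧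
      ∀ (n : ℕ) (T : ColoredChains.Template n m),
        (∀ x ∈ T.supp, (x.card : ℝ) ≤ θ * n) →
        (ColoredChains.omegaCrit 𝒢 β + α) * (n.choose (n / 2) : ℝ) ≤ T.weight β →
        T.HasContainers 𝒢 (Real.exp (K * (Real.log n / n) * T.size)) ε := by
  obtain ⟨K₁, hK₁, hsmall⟩ := ColoredChains.exists_hasContainers_of_lt h2 hsparse hβ hθ
  set K₂ : ℝ := ((1 - θ)⁻¹ + 1) * 𝒢.sup List.length
  have hK₂ : 0 ≤ K₂ := by have := inv_pos.2 (sub_pos.2 hθ); positivity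
  refine ⟨K₁ + K₂ + 1, by positivity, fun α hα => ?_⟩
  obtain ⟨ε₂, hε₂, hlarge⟩ := ColoredChains.eventually_hasContainers h2 hsparse hβ hθ hα
  obtain ⟨n₀, hlarge⟩ := Filter.eventually_atTop.1 hlarge
  obtain ⟨ε₁, hε₁, hsmall⟩ := hsmall n₀
  refine ⟨min ε₁ ε₂, lt_min hε₁ hε₂, fun n T hT hweight => ?_⟩
  have hlog : 0 ≤ Real.log n / n := div_nonneg (Real.log_natCast_nonneg n) (Nat.cast_nonneg n)
  rcases lt_or_ge n n₀ with hn | hn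
  · have hlt : ColoredChains.omegaCrit 𝒢 β * n.choose (n / 2) < T.weight β :=
      (mul_lt_mul_of_pos_right (lt_add_of_pos_right _ hα)
        (ColoredChains.choose_half_pos n)).trans_le hweight
    exact (hsmall n hn T hT hlt).mono (by gcongr; linarith) (min_le_left _ _)
  · exact (hlarge n hn T hT hweight).mono (by gcongr; linarith) (min_le_right _ _)

theorem mainTheorem5 (m : ℕ) (𝒢 : Finset (List (Fin m)))
    (h2 : ∀ g ∈ 𝒢, 2 ≤ g.length) (hsparse : ColoredChains.Sparse 𝒢)
    (β : Fin m → ℝ) (hβ : ∀ i, 0 < β i) :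
    ∃ K : ℝ, 0 < K ∧ ∀ α : ℝ, 0 < α → α < 1 → ∃ ε : ℝ, 0 < ε ∧
      ∀ (n : ℕ) (T : ColoredChains.Template n m),
        (∀ x ∈ T.supp, (n : ℝ) / 3 ≤ (x.card : ℝ) ∧ (x.card : ℝ) ≤ 2 * (n : ℝ) / 3) →
        (ColoredChains.omegaCrit 𝒢 β + α) * (n.choose (n / 2) : ℝ) ≤ T.weight β →
        ∃ 𝒞 : Finset (ColoredChains.Template n m),
          (∀ T' ∈ 𝒞, T' ≤ T) ∧
          (∀ I : ColoredChains.ColoredSubset n m, I.Valid 𝒢 → I.ContainedIn T →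
            ∃ T' ∈ 𝒞, I.ContainedIn T') ∧
          (𝒞.card : ℝ) ≤ Real.exp (K * (Real.log (n : ℝ) / (n : ℝ)) * (T.size : ℝ)) ∧
          ∀ T' ∈ 𝒞, (T'.size : ℝ) ≤ (1 - ε) * (T.size : ℝ) := by
  obtain ⟨K, hK, h⟩ := mainTheorem5_general m 𝒢 h2 hsparse β hβ (2 / 3) (by norm_num)
  exact ⟨K, hK, fun α hα _ => (h α hα).imp fun ε hε =>
    ⟨hε.1, fun n T hT => hε.2 n T fun x hx => (hT x hx).2.trans_eq (by ring)⟩⟩
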